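/- Let $n\ge 2$ and let $M$ be a nonempty $n$-dimensional smooth manifold with a Lorentzian metric $g$ of signature $(-,+,\dots,+)$, Levi-Civita connection $\nabla$, Ricci tensor $S$ and scalar curvature $r$. Let $\varphi$ be a smooth $(1,1)$-tensor field, $\zeta$ a smooth vector field and $\nu$ a smooth 1-form on $M$ such that, for all vector fields $E,F$, $$\nu(\zeta)=-1,\quad \varphi^2E=E+\nu(E)\zeta,\quad \varphi\zeta=0,\quad \nu(\varphi E)=0,$$ $$g(\varphi E,\varphi F)=g(E,F)+\nu(E)\nu(F),\quad g(E,\zeta)=\nu(E),\quad g(E,\varphi F)=g(F,\varphi E),$$ and suppose that $(\varphi,\zeta,\nu,g)$ is Lorentzian para-Kenmotsu (LP-Kenmotsu), that is $$(\nabla_E\varphi)F=-g(\varphi E,F)\zeta-\nu(F)\varphi E .$$ Assume that $r$ is constant on $M$. Let $K$ be a smooth vector field on $M$ and $\Lambda\in\mathbb R$. For $\sigma,\rho\in\mathbb R$ call $(g,K,\Lambda,\sigma,\rho)$ a Ricci–Yamabe soliton if $$\pounds_Kg+2\sigma S+(2\Lambda-\rho r)g=0;$$ it is shrinking if $\Lambda<0$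 and expanding if $\Lambda>0$. It is a Ricci soliton if $(\sigma,\rho)=(1,0)$, a Yamabe soliton if $(\sigma,\rho)=(0,1)$ and an Einstein soliton if $(\sigma,\rho)=(1,-1)$. Then: 1. if $(g,K,\Lambda)$ is a Ricci soliton, then $\Lambda=-(n-1)$, and the soliton is shrinking; 2. if $(g,K,\Lambda)$ is a Yamabe soliton, then $\Lambda=\frac{n(n-1)}2$, and the soliton is expanding; 3. if $(g,K,\Lambda)$ is an Einstein soliton, then $\Lambda=-\frac{(n-1)(n+2)}2$, and the soliton is shrinking. -/

import Mathlib

open scoped Manifold ContDiff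
open Bundle

/-! ## Levi-Civita calculus in a coordinate domain of `ℝⁿ` (index notation)

`G y` is the matrix `(g_ij)` of the metric at the coordinate point `y`. -/

namespace LocalGeom

variable {n : ℕ}

/-- The partial derivative `∂_i f`. -/
noncomputable def pd (i : Fin n) (f : EuclideanSpace ℝ (Fin n) → ℝ)
    (y : EuclideanSpace ℝ (Fin n)) : ℝ :=
  fderiv ℝ f y (EuclideanSpace.single i 1)

/-- The Christoffel symbols of the Levi-Civita connection,
`Γ^k_ij = ½ ∑_l g^kl (∂_i g_jl + ∂_j g_il - ∂_l g_ij)`, written `christoffel G k i j`;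
thus `∇_{∂_i} ∂_j = ∑_k Γ^k_ij ∂_k`. -/
noncomputable def christoffel (G : EuclideanSpace ℝ (Fin n) → Matrix (Fin n) (Fin n) ℝ)
    (k i j : Fin n) (y : EuclideanSpace ℝ (Fin n)) : ℝ :=
  (1 / 2) * ∑ l, (G y)⁻¹ k l *
    (pd i (fun z => G z j l) y + pd j (fun z => G z i l) y - pd l (fun z => G z i j) y)

/-- The curvature tensor `R(E,F)H = ∇_E ∇_F H - ∇_F ∇_E H - ∇_{[E,F]} H` in coordinates:
`curvature G l i j k` is the `l`-th component of `R(∂_i, ∂_j) ∂_k`. -/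
noncomputable def curvature (G : EuclideanSpace ℝ (Fin n) → Matrix (Fin n) (Fin n) ℝ)
    (l i j k : Fin n) (y : EuclideanSpace ℝ (Fin n)) : ℝ :=
  pd i (christoffel G l j k) y - pd j (christoffel G l i k) y
    + ∑ m, (christoffel G l i m y * christoffel G m j k y
      - christoffel G l j m y * christoffel G m i k y)

/-- The Ricci tensor `S(∂_j, ∂_k)`, the trace of `E ↦ R(E, ∂_j) ∂_k`. -/
noncomputable def ricci (G : EuclideanSpace ℝ (Fin n) → Matrix (Fin n) (Fin n) ℝ)
    (j k : Fin n) (y : EuclideanSpace ℝ (Fin n)) : ℝ :=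
  ∑ i, curvature G i i j k y

/-- The scalar curvature `r = ∑ g^jk S_jk`. -/
noncomputable def scalar (G : EuclideanSpace ℝ (Fin n) → Matrix (Fin n) (Fin n) ℝ)
    (y : EuclideanSpace ℝ (Fin n)) : ℝ :=
  ∑ j, ∑ k, (G y)⁻¹ j k * ricci G j k y

/-- The Lie derivative of the metric along the vector field with components `X`:
`(£_X g)_ij = ∑_k (X^k ∂_k g_ij + g_kj ∂_i X^k + g_ik ∂_j X^k)`. -/
noncomputable def lieMetric (G : EuclideanSpace ℝ (Fin n) → Matrix (Fin n) (Fin n) ℝ)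
    (X : Fin n → EuclideanSpace ℝ (Fin n) → ℝ) (i j : Fin n)
    (y : EuclideanSpace ℝ (Fin n)) : ℝ :=
  ∑ k, (X k y * pd k (fun z => G z i j) y + G y k j * pd i (X k) y + G y i k * pd j (X k) y)

/-- The covariant derivative of a `(1,1)`-tensor field `A = (A^k_j)`:
`covDerivEnd G A k i j` is the `k`-th component of `(∇_{∂_i} A) ∂_j`. -/
noncomputable def covDerivEnd (G : EuclideanSpace ℝ (Fin n) → Matrix (Fin n) (Fin n) ℝ)
    (A : Fin n → Fin n → EuclideanSpace ℝ (Fin n) → ℝ) (k i j : Fin n)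
    (y : EuclideanSpace ℝ (Fin n)) : ℝ :=
  pd i (A k j) y
    + ∑ l, (christoffel G k i l y * A l j y - christoffel G l i j y * A k l y)

end LocalGeom

/-! ## Lorentzian manifolds and their structures -/

section Manifold

variable (n : ℕ) (M : Type*) [TopologicalSpace M] [ChartedSpace (EuclideanSpace ℝ (Fin n)) M]
  [IsManifold (𝓡 n) ∞ M]

/-- A smooth Lorentzian metric, of signature `(-,+,…,+)`: at each point there is a timelike
vector on whose orthogonal complement the metric is positive definite. -/
structure LorentzianMetric where
  val : ∀ x : M, TangentSpace (𝓡 n) x →L[ℝ] TangentSpace (𝓡 n) x →L[ℝ] ℝ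
  symm : ∀ (x : M) (u v : TangentSpace (𝓡 n) x), val x u v = val x v u
  lorentzian : ∀ x : M, ∃ u : TangentSpace (𝓡 n) x, val x u u < 0 ∧
    ∀ v : TangentSpace (𝓡 n) x, v ≠ 0 → val x u v = 0 → 0 < val x v v
  contMDiff : ContMDiff (𝓡 n)
    ((𝓡 n).prod 𝓘(ℝ, EuclideanSpace ℝ (Fin n) →L[ℝ] EuclideanSpace ℝ (Fin n) →L[ℝ] ℝ)) ∞
    (fun x => TotalSpace.mk'
      (EuclideanSpace ℝ (Fin n) →L[ℝ] EuclideanSpace ℝ (Fin n) →L[ℝ] ℝ)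
      (E := fun x : M => TangentSpace (𝓡 n) x →L[ℝ] TangentSpace (𝓡 n) x →L[ℝ] ℝ) x (val x))

variable {n M}

/-- `X` is a smooth vector field on `M`. -/
def IsSmoothVectorField (X : ∀ x : M, TangentSpace (𝓡 n) x) : Prop :=
  ContMDiff (𝓡 n) ((𝓡 n).prod 𝓘(ℝ, EuclideanSpace ℝ (Fin n))) ∞
    (fun x => TotalSpace.mk' (EuclideanSpace ℝ (Fin n))
      (E := fun x : M => TangentSpace (𝓡 n) x) x (X x))

/-- The coordinate vector `∂_i` of the chart `e` at the point with coordinates `y`. -/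
noncomputable def coordVec (e : OpenPartialHomeomorph M (EuclideanSpace ℝ (Fin n))) (i : Fin n)
    (y : EuclideanSpace ℝ (Fin n)) : TangentSpace (𝓡 n) (e.symm y) :=
  mfderiv (𝓡 n) (𝓡 n) e.symm y
    (EuclideanSpace.single i 1 : EuclideanSpace ℝ (Fin n))

/-- The `i`-th component, in the chart `e`, of a tangent vector `v` at the point with
coordinates `y`. -/
noncomputable def coordComp (e : OpenPartialHomeomorph M (EuclideanSpace ℝ (Fin n))) (i : Fin n)
    (y : EuclideanSpace ℝ (Fin n)) (v : TangentSpace (𝓡 n) (e.symm y)) : ℝ :=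
  (show EuclideanSpace ℝ (Fin n) from mfderiv (𝓡 n) (𝓡 n) e (e.symm y) v) i

/-- The components `X^i` of a vector field in the chart `e`. -/
noncomputable def vecComp (e : OpenPartialHomeomorph M (EuclideanSpace ℝ (Fin n)))
    (X : ∀ x : M, TangentSpace (𝓡 n) x) (i : Fin n) (y : EuclideanSpace ℝ (Fin n)) : ℝ :=
  coordComp e i y (X (e.symm y))

/-- The components `A^i_j` of a `(1,1)`-tensor field in the chart `e`. -/
noncomputable def endComp (e : OpenPartialHomeomorph M (EuclideanSpace ℝ (Fin n)))
    (A : ∀ x : M, TangentSpace (𝓡 n) x →L[ℝ] TangentSpace (𝓡 n) x) (i j : Fin n)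
    (y : EuclideanSpace ℝ (Fin n)) : ℝ :=
  coordComp e i y (A (e.symm y) (coordVec e j y))

/-- The matrix `g_ij = g(∂_i, ∂_j)` of the metric in the chart `e`. -/
noncomputable def LorentzianMetric.coord (g : LorentzianMetric n M)
    (e : OpenPartialHomeomorph M (EuclideanSpace ℝ (Fin n)))
    (y : EuclideanSpace ℝ (Fin n)) : Matrix (Fin n) (Fin n) ℝ :=
  Matrix.of fun i j => g.val (e.symm y) (coordVec e i y) (coordVec e j y)

/-- A Lorentzian almost paracontact metric structure `(φ, ζ, ν, g)` on `M`, for a given `g`. -/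
structure AlmostParacontact (g : LorentzianMetric n M) where
  φ : ∀ x : M, TangentSpace (𝓡 n) x →L[ℝ] TangentSpace (𝓡 n) x
  ζ : ∀ x : M, TangentSpace (𝓡 n) x
  ν : ∀ x : M, TangentSpace (𝓡 n) x →L[ℝ] ℝ
  smooth_φ : ContMDiff (𝓡 n)
    ((𝓡 n).prod 𝓘(ℝ, EuclideanSpace ℝ (Fin n) →L[ℝ] EuclideanSpace ℝ (Fin n))) ∞
    (fun x => TotalSpace.mk' (EuclideanSpace ℝ (Fin n) →L[ℝ] EuclideanSpace ℝ (Fin n))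
      (E := fun x : M => TangentSpace (𝓡 n) x →L[ℝ] TangentSpace (𝓡 n) x) x (φ x))
  smooth_ζ : IsSmoothVectorField ζ
  smooth_ν : ContMDiff (𝓡 n)
    ((𝓡 n).prod 𝓘(ℝ, EuclideanSpace ℝ (Fin n) →L[ℝ] ℝ)) ∞
    (fun x => TotalSpace.mk' (EuclideanSpace ℝ (Fin n) →L[ℝ] ℝ)
      (E := fun x : M => TangentSpace (𝓡 n) x →L[ℝ] ℝ) x (ν x))
  ν_ζ : ∀ x, ν x (ζ x) + 1 = 0
  φ_sq : ∀ (x : M) (u : TangentSpace (𝓡 n) x), φ x (φ x u) = u + ν x u • ζ x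
  φ_ζ : ∀ x, φ x (ζ x) = 0
  ν_φ : ∀ (x : M) (u : TangentSpace (𝓡 n) x), ν x (φ x u) = 0
  metric_φ : ∀ (x : M) (u v : TangentSpace (𝓡 n) x),
    g.val x (φ x u) (φ x v) = g.val x u v + ν x u * ν x v
  metric_ζ : ∀ (x : M) (u : TangentSpace (𝓡 n) x), g.val x u (ζ x) = ν x u
  φ_symm : ∀ (x : M) (u v : TangentSpace (𝓡 n) x), g.val x u (φ x v) = g.val x v (φ x u)

/-- The structure is Lorentzian para-Kenmotsu:
`(∇_E φ) F = - g(φ E, F) ζ - ν(F) φ E`, evaluated on coordinate vectors `E = ∂_i`, `F = ∂_j` at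
every point of every chart of the atlas. -/
def AlmostParacontact.IsLPKenmotsu {g : LorentzianMetric n M} (P : AlmostParacontact g) : Prop :=
  ∀ e ∈ atlas (EuclideanSpace ℝ (Fin n)) M, ∀ y ∈ e.target, ∀ k i j : Fin n,
    LocalGeom.covDerivEnd (g.coord e) (endComp e P.φ) k i j y =
      - g.val (e.symm y) (P.φ (e.symm y) (coordVec e i y)) (coordVec e j y) * vecComp e P.ζ k y
      - P.ν (e.symm y) (coordVec e j y) * endComp e P.φ k i y

/-- The scalar curvature `r` of `g` is constant on `M`. -/
def LorentzianMetric.HasConstantScalarCurvature (g : LorentzianMetric n M) : Prop :=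
  ∃ c : ℝ, ∀ e ∈ atlas (EuclideanSpace ℝ (Fin n)) M, ∀ y ∈ e.target,
    LocalGeom.scalar (g.coord e) y = c

/-- `(g, K, Λ, σ, ρ)` is a Ricci-Yamabe soliton: `K` is a smooth vector field and
`£_K g + 2 σ S + (2 Λ - ρ r) g = 0`. -/
def IsRicciYamabeSoliton (g : LorentzianMetric n M) (K : ∀ x : M, TangentSpace (𝓡 n) x)
    (Λ σ ρ : ℝ) : Prop :=
  IsSmoothVectorField K ∧
  ∀ e ∈ atlas (EuclideanSpace ℝ (Fin n)) M, ∀ y ∈ e.target, ∀ i j : Fin n,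
    LocalGeom.lieMetric (g.coord e) (vecComp e K) i j y
      + 2 * σ * LocalGeom.ricci (g.coord e) i j y
      + (2 * Λ - ρ * LocalGeom.scalar (g.coord e) y) * g.coord e y i j = 0

/-- Ricci soliton: a Ricci-Yamabe soliton with `σ = 1`, `ρ = 0`. -/
def IsRicciSoliton (g : LorentzianMetric n M) (K : ∀ x : M, TangentSpace (𝓡 n) x)
    (Λ : ℝ) : Prop :=
  IsRicciYamabeSoliton g K Λ 1 0

/-- Yamabe soliton: a Ricci-Yamabe soliton with `σ = 0`, `ρ = 1`. -/
def IsYamabeSoliton (g : LorentzianMetric n M) (K : ∀ x : M, TangentSpace (𝓡 n) x)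
    (Λ : ℝ) : Prop :=
  IsRicciYamabeSoliton g K Λ 0 1

/-- Einstein soliton: a Ricci-Yamabe soliton with `σ = 1`, `ρ = -1`. -/
def IsEinsteinSoliton (g : LorentzianMetric n M) (K : ∀ x : M, TangentSpace (𝓡 n) x)
    (Λ : ℝ) : Prop :=
  IsRicciYamabeSoliton g K Λ 1 (-1)

end Manifold

/-- A soliton with constant `Λ` is shrinking if `Λ < 0`. -/
def SolitonShrinking (Λ : ℝ) : Prop := Λ < 0

/-- A soliton with constant `Λ` is expanding if `Λ > 0`. -/
def SolitonExpanding (Λ : ℝ) : Prop := 0 < Λ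

/-! ## Calculus of connections and tensor fields on an open subset of a vector space -/

namespace FlatCalculus

set_option maxSynthPendingDepth 3

variable {E F G : Type*} [NormedAddCommGroup E] [NormedSpace ℝ E]
  [NormedAddCommGroup F] [NormedSpace ℝ F] [NormedAddCommGroup G] [NormedSpace ℝ G]

open ContinuousLinearMap

/-! Everything happens in one chart, where the connection is `∇_u v = D_u v + Γ(u,v)` on an open set
of a vector space. From `φ` only the identity `∇_u ζ = -u - ν(u)ζ` is retained: it follows by
differentiating `φζ = 0` and `g(ζ,ζ) = -1`, and it is the last field of `KenmotsuOn`. It forces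
`R(u,v)ζ = ν(v)u - ν(u)v` (`curv_ζ`), hence `S(·,ζ) = (n-1)ν`. Write `γ = g + ν ⊗ ν`.

Scalar curvature. Here `£_ζ g = -2γ`. The general formula for `£_X R` through `£_X ∇`
(`lieCurv_curv`), with `£_X ∇` computed from `£_X g` (`metric_lieConn`), gives after a trace `£_ζ S
= -2(n-1)γ`. So the tensor `S - (n-1)g` (`excess`) is invariant under `ζ`, while the endomorphism
`T` obtained by raising an index satisfies `£_ζ T = 2T`. Its trace is `r - n(n-1)`, so `ζ(r) = 2(r -
n(n-1))`, and constancy of `r` forces `r = n(n-1)` (`tr_T_eq_zero`).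

Soliton constant. With `r` constant, `f = 2Λ - ρr` is a number, and `∇(£_K g) = -2σ∇(S - (n-1)g)`.
This gives `(£_K ∇)(u,ζ) = -2σ T u`, and then `(£_K R)(u,ζ)ζ = 0` (`lieCurv_soliton`). Comparison
with the Lie derivative of `R(u,ζ)ζ = -(u + ν(u)ζ)` yields `ν([K,ζ]) = 0`, which needs a nonzero
vector in `ker ν` and so `n ≥ 2`. Therefore `(£_K g)(ζ,ζ) = 0`, and the soliton equation on `(ζ,ζ)`
reads `f = -2σ(n-1)` (`soliton_constant`). The three cases are arithmetic from the two values. -/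

lemma fderiv_apply_apply {c : E → F →L[ℝ] G} {u : E → F} {x : E} (hc : DifferentiableAt ℝ c x)
    (hu : DifferentiableAt ℝ u x) (a : E) :
    fderiv ℝ (fun y => c y (u y)) x a = fderiv ℝ c x a (u x) + c x (fderiv ℝ u x a) := by
  rw [fderiv_clm_apply hc hu]
  simp [add_comm]

lemma fderiv_apply_const {c : E → F →L[ℝ] G} {x : E} (hc : DifferentiableAt ℝ c x) (u : F)
    (a : E) : fderiv ℝ (fun y => c y u) x a = fderiv ℝ c x a u := by
  rw [fderiv_apply_apply hc (by fun_prop)]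
  simp

lemma fderiv_apply_const₂ {F' : Type*} [NormedAddCommGroup F'] [NormedSpace ℝ F']
    {c : E → F →L[ℝ] F' →L[ℝ] G} {x : E} (hc : DifferentiableAt ℝ c x) (u : F) (v : F') (a : E) :
    fderiv ℝ (fun y => c y u v) x a = fderiv ℝ c x a u v := by
  rw [fderiv_apply_const (c := fun y => c y u) (by fun_prop), fderiv_apply_const hc]

lemma fderiv_const_apply (c : F →L[ℝ] G) {u : E → F} {x : E} (hu : DifferentiableAt ℝ u x)
    (a : E) : fderiv ℝ (fun y => c (u y)) x a = c (fderiv ℝ u x a) := by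
  rw [fderiv_apply_apply (by fun_prop) hu]
  simp

lemma fderiv_add_apply {f h : E → F} {x : E} (hf : DifferentiableAt ℝ f x)
    (hh : DifferentiableAt ℝ h x) (a : E) :
    fderiv ℝ (fun y => f y + h y) x a = fderiv ℝ f x a + fderiv ℝ h x a := by
  rw [fderiv_fun_add hf hh]; rfl

lemma fderiv_sub_apply {f h : E → F} {x : E} (hf : DifferentiableAt ℝ f x)
    (hh : DifferentiableAt ℝ h x) (a : E) :
    fderiv ℝ (fun y => f y - h y) x a = fderiv ℝ f x a - fderiv ℝ h x a := by
  rw [fderiv_fun_sub hf hh]; rfl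

lemma fderiv_neg_apply (f : E → F) (x : E) (a : E) :
    fderiv ℝ (fun y => - f y) x a = - fderiv ℝ f x a := by
  rw [fderiv_fun_neg]; rfl

lemma fderiv_smul_apply {c : E → ℝ} {f : E → F} {x : E} (hc : DifferentiableAt ℝ c x)
    (hf : DifferentiableAt ℝ f x) (a : E) :
    fderiv ℝ (fun y => c y • f y) x a = fderiv ℝ c x a • f x + c x • fderiv ℝ f x a := by
  rw [fderiv_fun_smul hc hf]; simp [add_comm]

lemma fderiv_mul_apply {c f : E → ℝ} {x : E} (hc : DifferentiableAt ℝ c x)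
    (hf : DifferentiableAt ℝ f x) (a : E) :
    fderiv ℝ (fun y => c y * f y) x a = fderiv ℝ c x a * f x + c x * fderiv ℝ f x a :=
  fderiv_smul_apply hc hf a

lemma fderiv_congr_on {U : Set E} (hU : IsOpen U) {y : E} (hy : y ∈ U) {f h : E → F}
    (hfh : ∀ z ∈ U, f z = h z) : fderiv ℝ f y = fderiv ℝ h y :=
  Filter.EventuallyEq.fderiv_eq (Filter.eventually_of_mem (hU.mem_nhds hy) hfh)

lemma contDiffOn_fderiv {U : Set E} (hU : IsOpen U) {f : E → F} (hf : ContDiffOn ℝ ∞ f U) :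
    ContDiffOn ℝ ∞ (fderiv ℝ f) U := hf.fderiv_of_isOpen hU (by simp)

lemma differentiableAt_of_mem {U : Set E} (hU : IsOpen U) {f : E → F} (hf : ContDiffOn ℝ ∞ f U)
    {y : E} (hy : y ∈ U) : DifferentiableAt ℝ f y :=
  (hf.contDiffAt (hU.mem_nhds hy)).differentiableAt (by simp)

lemma fderiv_fderiv_comm {U : Set E} (hU : IsOpen U) {f : E → F} (hf : ContDiffOn ℝ ∞ f U)
    {y : E} (hy : y ∈ U) (a b : E) :
    fderiv ℝ (fderiv ℝ f) y a b = fderiv ℝ (fderiv ℝ f) y b a :=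
  ((hf.contDiffAt (hU.mem_nhds hy)).isSymmSndFDerivAt
    (by simp; exact WithTop.coe_le_coe.2 (le_top (a := (2 : ℕ∞))))).eq a b

/-- The curvature `R(u,v)w` of the connection `∇_u v = D_u v + Γ(u,v)`. -/
noncomputable def curv (Γ : E → E →L[ℝ] E →L[ℝ] E) (y : E) : E →L[ℝ] E →L[ℝ] E →L[ℝ] E :=
  fderiv ℝ Γ y - (fderiv ℝ Γ y).flip + (compL ℝ E E E).bilinearComp (Γ y) (Γ y)
    - ((compL ℝ E E E).bilinearComp (Γ y) (Γ y)).flip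

lemma curv_apply (Γ : E → E →L[ℝ] E →L[ℝ] E) (y u v w : E) :
    curv Γ y u v w = fderiv ℝ Γ y u v w - fderiv ℝ Γ y v u w + Γ y u (Γ y v w)
      - Γ y v (Γ y u w) := rfl

/-- The Lie derivative `(£_X ∇)(u,v)` of a connection along a vector field. -/
noncomputable def lieConn (Γ : E → E →L[ℝ] E →L[ℝ] E) (X : E → E) (y : E) :
    E →L[ℝ] E →L[ℝ] E :=
  fderiv ℝ Γ y (X y) + (Γ y).comp (fderiv ℝ X y)
    + (Γ y).bilinearComp (ContinuousLinearMap.id ℝ E) (fderiv ℝ X y)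
    - (compL ℝ E E E (fderiv ℝ X y)).comp (Γ y) + fderiv ℝ (fderiv ℝ X) y

lemma lieConn_apply (Γ : E → E →L[ℝ] E →L[ℝ] E) (X : E → E) (y u v : E) :
    lieConn Γ X y u v = fderiv ℝ Γ y (X y) u v + Γ y (fderiv ℝ X y u) v
      + Γ y u (fderiv ℝ X y v) - fderiv ℝ X y (Γ y u v) + fderiv ℝ (fderiv ℝ X) y u v := rfl

/-- The covariant derivative `(∇_a A)(u,v)` of a vector valued bilinear tensor field. -/
noncomputable def covVec (Γ A : E → E →L[ℝ] E →L[ℝ] E) (y a u v : E) : E :=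
  fderiv ℝ A y a u v + Γ y a (A y u v) - A y (Γ y a u) v - A y u (Γ y a v)

/-- The covariant derivative `(∇_a h)(u,v)` of a bilinear form. -/
noncomputable def covBil (Γ : E → E →L[ℝ] E →L[ℝ] E) (h : E → E →L[ℝ] E →L[ℝ] ℝ)
    (y a u v : E) : ℝ :=
  fderiv ℝ h y a u v - h y (Γ y a u) v - h y u (Γ y a v)

/-- The Lie derivative of a bilinear form. -/
noncomputable def lieBil (X : E → E) (h : E → E →L[ℝ] E →L[ℝ] ℝ) (y : E) : E →L[ℝ] E →L[ℝ] ℝ :=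
  fderiv ℝ h y (X y) + (h y).comp (fderiv ℝ X y)
    + (h y).bilinearComp (ContinuousLinearMap.id ℝ E) (fderiv ℝ X y)

lemma lieBil_apply (X : E → E) (h : E → E →L[ℝ] E →L[ℝ] ℝ) (y u v : E) :
    lieBil X h y u v = fderiv ℝ h y (X y) u v + h y (fderiv ℝ X y u) v
      + h y u (fderiv ℝ X y v) := rfl

/-- The Lie derivative of a tensor field of curvature type. -/
noncomputable def lieCurv (X : E → E) (R : E → E →L[ℝ] E →L[ℝ] E →L[ℝ] E) (y u v w : E) : E :=
  fderiv ℝ R y (X y) u v w + R y (fderiv ℝ X y u) v w + R y u (fderiv ℝ X y v) w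
    + R y u v (fderiv ℝ X y w) - fderiv ℝ X y (R y u v w)

section FiniteDim

variable [FiniteDimensional ℝ E]

lemma contDiffOn_curv {U : Set E} (hU : IsOpen U) {Γ : E → E →L[ℝ] E →L[ℝ] E}
    (hΓ : ContDiffOn ℝ ∞ Γ U) : ContDiffOn ℝ ∞ (curv Γ) U := by
  have h1 := contDiffOn_fderiv hU hΓ
  refine contDiffOn_clm_apply.2 fun u => contDiffOn_clm_apply.2 fun v =>
    contDiffOn_clm_apply.2 fun w => ?_
  simp only [curv_apply]
  apply_rules [ContDiffOn.add, ContDiffOn.sub, ContDiffOn.clm_apply, contDiffOn_const]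

lemma contDiffOn_lieConn {U : Set E} (hU : IsOpen U) {Γ : E → E →L[ℝ] E →L[ℝ] E} {X : E → E}
    (hΓ : ContDiffOn ℝ ∞ Γ U) (hX : ContDiffOn ℝ ∞ X U) : ContDiffOn ℝ ∞ (lieConn Γ X) U := by
  have h1 := contDiffOn_fderiv hU hΓ
  have h2 := contDiffOn_fderiv hU hX
  have h3 := contDiffOn_fderiv hU h2
  refine contDiffOn_clm_apply.2 fun u => contDiffOn_clm_apply.2 fun v => ?_
  simp only [lieConn_apply]
  apply_rules [ContDiffOn.add, ContDiffOn.sub, ContDiffOn.clm_apply, contDiffOn_const]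

lemma contDiffOn_lieBil {U : Set E} (hU : IsOpen U) {h : E → E →L[ℝ] E →L[ℝ] ℝ} {X : E → E}
    (hh : ContDiffOn ℝ ∞ h U) (hX : ContDiffOn ℝ ∞ X U) : ContDiffOn ℝ ∞ (lieBil X h) U := by
  have h1 := contDiffOn_fderiv hU hh
  have h2 := contDiffOn_fderiv hU hX
  refine contDiffOn_clm_apply.2 fun u => contDiffOn_clm_apply.2 fun v => ?_
  simp only [lieBil_apply]
  apply_rules [ContDiffOn.add, ContDiffOn.clm_apply, contDiffOn_const]

variable {U : Set E} {Γ : E → E →L[ℝ] E →L[ℝ] E} {X : E → E} {y : E}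

lemma fderiv_curv_apply (hU : IsOpen U) (hΓ : ContDiffOn ℝ ∞ Γ U) (hy : y ∈ U) (a u v w : E) :
    fderiv ℝ (curv Γ) y a u v w = fderiv ℝ (fderiv ℝ Γ) y a u v w
      - fderiv ℝ (fderiv ℝ Γ) y a v u w + (fderiv ℝ Γ y a u (Γ y v w)
      + Γ y u (fderiv ℝ Γ y a v w)) - (fderiv ℝ Γ y a v (Γ y u w)
      + Γ y v (fderiv ℝ Γ y a u w)) := by
  have h0 := differentiableAt_of_mem hU hΓ hy
  have h1 := differentiableAt_of_mem hU (contDiffOn_fderiv hU hΓ) hy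
  have h2 := differentiableAt_of_mem hU (contDiffOn_curv hU hΓ) hy
  rw [← fderiv_apply_const h2, ← fderiv_apply_const₂ (c := fun z => curv Γ z u) (by fun_prop)]
  simp only [curv_apply]
  generalize hP : fderiv ℝ Γ = P at *
  simp (disch := fun_prop) only [hP, fderiv_add_apply, fderiv_sub_apply, fderiv_apply_apply,
    fderiv_fun_const, Pi.zero_apply, _root_.zero_apply, map_zero, add_zero]

lemma fderiv_lieConn_apply (hU : IsOpen U) (hΓ : ContDiffOn ℝ ∞ Γ U) (hX : ContDiffOn ℝ ∞ X U)
    (hy : y ∈ U) (a u v : E) :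
    fderiv ℝ (lieConn Γ X) y a u v = fderiv ℝ (fderiv ℝ Γ) y a (X y) u v
      + fderiv ℝ Γ y (fderiv ℝ X y a) u v
      + (fderiv ℝ Γ y a (fderiv ℝ X y u) v + Γ y (fderiv ℝ (fderiv ℝ X) y a u) v)
      + (fderiv ℝ Γ y a u (fderiv ℝ X y v) + Γ y u (fderiv ℝ (fderiv ℝ X) y a v))
      - (fderiv ℝ (fderiv ℝ X) y a (Γ y u v) + fderiv ℝ X y (fderiv ℝ Γ y a u v))
      + fderiv ℝ (fderiv ℝ (fderiv ℝ X)) y a u v := by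
  have h0 := differentiableAt_of_mem hU hΓ hy
  have h1 := differentiableAt_of_mem hU (contDiffOn_fderiv hU hΓ) hy
  have k0 := differentiableAt_of_mem hU hX hy
  have k1 := differentiableAt_of_mem hU (contDiffOn_fderiv hU hX) hy
  have k2 := differentiableAt_of_mem hU (contDiffOn_fderiv hU (contDiffOn_fderiv hU hX)) hy
  have h2 := differentiableAt_of_mem hU (contDiffOn_lieConn hU hΓ hX) hy
  rw [← fderiv_apply_const₂ h2]
  simp only [lieConn_apply]
  -- The second derivative is made an atom before the first, because it contains the first.
  generalize hQ : fderiv ℝ (fderiv ℝ X) = Q at *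
  generalize hP : fderiv ℝ Γ = P at *
  generalize hP' : fderiv ℝ X = P' at *
  simp (disch := fun_prop) only [hP, hP', hQ, fderiv_add_apply, fderiv_sub_apply, fderiv_apply_apply,
    fderiv_fun_const, Pi.zero_apply, _root_.zero_apply, map_zero, add_zero,
    _root_.add_apply]

/-- The Lie derivative of the curvature in terms of that of the connection. -/
theorem lieCurv_curv (hU : IsOpen U) (hΓ : ContDiffOn ℝ ∞ Γ U) (hX : ContDiffOn ℝ ∞ X U)
    (hs : ∀ z ∈ U, ∀ u v, Γ z u v = Γ z v u) (hy : y ∈ U) (u v w : E) :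
    lieCurv X (curv Γ) y u v w
      = covVec Γ (lieConn Γ X) y u v w - covVec Γ (lieConn Γ X) y v u w := by
  have e1 := fderiv_fderiv_comm hU hΓ hy
  have e2 := fderiv_fderiv_comm hU hX hy
  have e3 := fderiv_fderiv_comm hU (contDiffOn_fderiv hU hX) hy
  have e := hs y hy
  simp only [lieCurv, covVec, fderiv_curv_apply hU hΓ hy, fderiv_lieConn_apply hU hΓ hX hy,
    curv_apply, lieConn_apply, map_add, map_sub]
  -- After full expansion only symmetries are needed: third derivatives of `X` and second
  -- derivatives of `Γ` commute, and absence of torsion cancels the terms in `Γ(u,v) - Γ(v,u)`.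
  rw [e3 v u, e1 (X y) u, e1 (X y) v, e2 v u, e v u]
  abel

end FiniteDim

end FlatCalculus

/-! ### Symmetries of the curvature, and Lie derivatives of a Levi-Civita connection. -/

namespace FlatCalculus

variable {E : Type*} [NormedAddCommGroup E] [NormedSpace ℝ E]

open ContinuousLinearMap

set_option maxSynthPendingDepth 3

variable {U : Set E} {Γ : E → E →L[ℝ] E →L[ℝ] E} {g : E → E →L[ℝ] E →L[ℝ] ℝ} {X : E → E} {y : E}

lemma fderiv_symm {F : Type*} [NormedAddCommGroup F] [NormedSpace ℝ F]
    {Γ : E → E →L[ℝ] E →L[ℝ] F} (hU : IsOpen U) (hΓ : ContDiffOn ℝ ∞ Γ U)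
    (hs : ∀ z ∈ U, ∀ u v, Γ z u v = Γ z v u) (hy : y ∈ U) (a u v : E) :
    fderiv ℝ Γ y a u v = fderiv ℝ Γ y a v u := by
  have h0 := differentiableAt_of_mem hU hΓ hy
  rw [← fderiv_apply_const₂ h0, ← fderiv_apply_const₂ h0,
    fderiv_congr_on hU hy fun z hz => hs z hz u v]

lemma lieConn_symm (hU : IsOpen U) (hΓ : ContDiffOn ℝ ∞ Γ U) (hX : ContDiffOn ℝ ∞ X U)
    (hs : ∀ z ∈ U, ∀ u v, Γ z u v = Γ z v u) (hy : y ∈ U) (u v : E) :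
    lieConn Γ X y u v = lieConn Γ X y v u := by
  rw [lieConn_apply, lieConn_apply, fderiv_fderiv_comm hU hX hy u v,
    fderiv_symm hU hΓ hs hy _ u v, hs y hy u v, hs y hy u (fderiv ℝ X y v),
    hs y hy v (fderiv ℝ X y u)]
  abel

/-- The first Bianchi identity. -/
lemma curv_bianchi (hU : IsOpen U) (hΓ : ContDiffOn ℝ ∞ Γ U)
    (hs : ∀ z ∈ U, ∀ u v, Γ z u v = Γ z v u) (hy : y ∈ U) (u v w : E) :
    curv Γ y u v w + curv Γ y v w u + curv Γ y w u v = 0 := by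
  simp only [curv_apply]
  rw [fderiv_symm hU hΓ hs hy u w v, fderiv_symm hU hΓ hs hy v w u,
    fderiv_symm hU hΓ hs hy w v u, hs y hy w v, hs y hy w u, hs y hy v u]
  abel

lemma curv_antisymm (u v w : E) : curv Γ y u v w = - curv Γ y v u w := by
  simp only [curv_apply]
  abel

lemma fderiv_fderiv_metric (hU : IsOpen U) (hΓ : ContDiffOn ℝ ∞ Γ U) (hg : ContDiffOn ℝ ∞ g U)
    (hc : ∀ z ∈ U, ∀ a u v, fderiv ℝ g z a u v = g z (Γ z a u) v + g z u (Γ z a v))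
    (hy : y ∈ U) (a b u v : E) :
    fderiv ℝ (fderiv ℝ g) y b a u v
      = fderiv ℝ g y b (Γ y a u) v + g y (fderiv ℝ Γ y b a u) v
        + (fderiv ℝ g y b u (Γ y a v) + g y u (fderiv ℝ Γ y b a v)) := by
  have h0 := differentiableAt_of_mem hU hΓ hy
  have h1 := differentiableAt_of_mem hU hg hy
  have h2 := differentiableAt_of_mem hU (contDiffOn_fderiv hU hg) hy
  rw [← fderiv_apply_const h2, ← fderiv_apply_const₂ (c := fun z => fderiv ℝ g z a) (by fun_prop),
    fderiv_congr_on hU hy fun z hz => hc z hz a u v]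
  simp (disch := fun_prop) only [fderiv_add_apply, fderiv_apply_apply, fderiv_fun_const,
    Pi.zero_apply, _root_.zero_apply, map_zero, add_zero, _root_.add_apply]

/-- The curvature of a metric connection is skew-adjoint. -/
lemma metric_curv (hU : IsOpen U) (hΓ : ContDiffOn ℝ ∞ Γ U) (hg : ContDiffOn ℝ ∞ g U)
    (hc : ∀ z ∈ U, ∀ a u v, fderiv ℝ g z a u v = g z (Γ z a u) v + g z u (Γ z a v))
    (hy : y ∈ U) (u v w z : E) :
    g y (curv Γ y u v w) z = - g y w (curv Γ y u v z) := by
  -- Compatibility expresses the second derivative of `g` through `Γ`; its antisymmetric part in `u,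
  -- v` vanishes, and that is the claim.
  have h := fderiv_fderiv_comm hU hg hy u v
  have h' := congrArg (fun f => f w z) h
  simp only [fderiv_fderiv_metric hU hΓ hg hc hy, hc y hy] at h'
  simp only [curv_apply, map_add, map_sub, _root_.add_apply, _root_.sub_apply]
  linarith

/-- Symmetry of the curvature of a Levi-Civita connection under exchange of pairs. -/
lemma metric_curv_pair (hU : IsOpen U) (hΓ : ContDiffOn ℝ ∞ Γ U) (hg : ContDiffOn ℝ ∞ g U)
    (hs : ∀ z ∈ U, ∀ u v, Γ z u v = Γ z v u) (hgs : ∀ z ∈ U, ∀ u v, g z u v = g z v u)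
    (hc : ∀ z ∈ U, ∀ a u v, fderiv ℝ g z a u v = g z (Γ z a u) v + g z u (Γ z a v))
    (hy : y ∈ U) (u v w z : E) :
    g y (curv Γ y u v w) z = g y (curv Γ y w z u) v := by
  have B : ∀ a b c d : E, g y (curv Γ y a b c) d + g y (curv Γ y b c a) d
      + g y (curv Γ y c a b) d = 0 := fun a b c d => by
    simpa using congrArg (fun f => g y f d) (curv_bianchi hU hΓ hs hy a b c)
  have S1 : ∀ a b c d : E, g y (curv Γ y a b c) d = - g y (curv Γ y b a c) d := fun a b c d => by
    rw [curv_antisymm]; simp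
  have S2 : ∀ a b c d : E, g y (curv Γ y a b c) d = - g y (curv Γ y a b d) c := fun a b c d => by
    rw [metric_curv hU hΓ hg hc hy, hgs y hy]
  -- The octahedron argument: a combination of four Bianchi identities, with both skew-symmetries
  -- used to match terms.
  linarith [B u v w z, B v w z u, B w z u v, B z u v w, S2 u v w z, S2 v w u z, S2 w u v z,
    S1 w u v z, S1 z u v w, S1 w z u v, S2 w z u v, S2 z u w v, S2 v z u w, S2 z v w u,
    S2 u w v z, S2 v w z u, S2 z u v w, S2 u v z w, S1 u w v z, S1 v z w u, S1 z v w u,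
    S1 u z v w, S1 v w z u, S1 v w u z, S2 u v w z, S2 w z v u, S1 z u w v, S1 u v z w]

section FiniteDim

variable [FiniteDimensional ℝ E]

lemma fderiv_lieBil_apply (hU : IsOpen U) (hg : ContDiffOn ℝ ∞ g U) (hX : ContDiffOn ℝ ∞ X U)
    (hy : y ∈ U) (a u v : E) :
    fderiv ℝ (lieBil X g) y a u v = fderiv ℝ (fderiv ℝ g) y a (X y) u v
      + fderiv ℝ g y (fderiv ℝ X y a) u v
      + (fderiv ℝ g y a (fderiv ℝ X y u) v + g y (fderiv ℝ (fderiv ℝ X) y a u) v)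
      + (fderiv ℝ g y a u (fderiv ℝ X y v) + g y u (fderiv ℝ (fderiv ℝ X) y a v)) := by
  have h0 := differentiableAt_of_mem hU hg hy
  have h1 := differentiableAt_of_mem hU (contDiffOn_fderiv hU hg) hy
  have k0 := differentiableAt_of_mem hU hX hy
  have k1 := differentiableAt_of_mem hU (contDiffOn_fderiv hU hX) hy
  have h2 := differentiableAt_of_mem hU (contDiffOn_lieBil hU hg hX) hy
  rw [← fderiv_apply_const₂ h2]
  simp only [lieBil_apply]
  generalize hP : fderiv ℝ g = P at *
  generalize hP' : fderiv ℝ X = P' at *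
  simp (disch := fun_prop) only [hP, hP', fderiv_add_apply, fderiv_apply_apply,
    fderiv_fun_const, Pi.zero_apply, _root_.zero_apply, map_zero, add_zero, _root_.add_apply]

/-- Since `∇g = 0`, commuting `£_X` past `∇` leaves only the action of `£_X ∇` on the two slots of
`g`. -/
lemma covBil_lieBil (hU : IsOpen U) (hΓ : ContDiffOn ℝ ∞ Γ U) (hg : ContDiffOn ℝ ∞ g U)
    (hX : ContDiffOn ℝ ∞ X U)
    (hc : ∀ z ∈ U, ∀ a u v, fderiv ℝ g z a u v = g z (Γ z a u) v + g z u (Γ z a v))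
    (hy : y ∈ U) (a u v : E) :
    covBil Γ (lieBil X g) y a u v = g y (lieConn Γ X y a u) v + g y u (lieConn Γ X y a v) := by
  simp only [covBil, fderiv_lieBil_apply hU hg hX hy, fderiv_fderiv_comm hU hg hy a (X y),
    fderiv_fderiv_metric hU hΓ hg hc hy, lieBil_apply, lieConn_apply, hc y hy, map_add, map_sub,
    _root_.add_apply, _root_.sub_apply]
  ring

/-- The Lie derivative of the Levi-Civita connection in terms of that of the metric. -/
theorem metric_lieConn (hU : IsOpen U) (hΓ : ContDiffOn ℝ ∞ Γ U) (hg : ContDiffOn ℝ ∞ g U)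
    (hX : ContDiffOn ℝ ∞ X U) (hs : ∀ z ∈ U, ∀ u v, Γ z u v = Γ z v u)
    (hgs : ∀ z ∈ U, ∀ u v, g z u v = g z v u)
    (hc : ∀ z ∈ U, ∀ a u v, fderiv ℝ g z a u v = g z (Γ z a u) v + g z u (Γ z a v))
    (hy : y ∈ U) (u v w : E) :
    2 * g y (lieConn Γ X y u v) w = covBil Γ (lieBil X g) y u v w
      + covBil Γ (lieBil X g) y v u w - covBil Γ (lieBil X g) y w u v := by
  have hA := lieConn_symm hU hΓ hX hs hy
  simp only [covBil_lieBil hU hΓ hg hX hc hy]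
  -- The Koszul trick: `£_X ∇` is symmetric, so the cyclic combination isolates a single term.
  rw [hA v u, hA w u, hA w v, hgs y hy (lieConn Γ X y u w) v]
  ring

end FiniteDim

end FlatCalculus

/-! ### LP-Kenmotsu structures on an open set: curvature and Lie derivatives along `ζ`. -/

namespace FlatCalculus

variable {E : Type*} [NormedAddCommGroup E] [NormedSpace ℝ E]

open ContinuousLinearMap

set_option maxSynthPendingDepth 3

/-- An LP-Kenmotsu structure on an open subset `U` of a vector space: a metric `g`, its
Levi-Civita connection `Γ`, the vector field `ζ` and the dual form `ν`, with
`∇_u ζ = - u - ν(u) ζ`. -/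
structure KenmotsuOn (U : Set E) (g : E → E →L[ℝ] E →L[ℝ] ℝ) (Γ : E → E →L[ℝ] E →L[ℝ] E)
    (ζ : E → E) (ν : E → E →L[ℝ] ℝ) : Prop where
  isOpen : IsOpen U
  smooth_g : ContDiffOn ℝ ∞ g U
  smooth_Γ : ContDiffOn ℝ ∞ Γ U
  smooth_ζ : ContDiffOn ℝ ∞ ζ U
  smooth_ν : ContDiffOn ℝ ∞ ν U
  symm_g : ∀ y ∈ U, ∀ u v, g y u v = g y v u
  nondeg : ∀ y ∈ U, ∀ u, (∀ v, g y u v = 0) → u = 0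
  symm_Γ : ∀ y ∈ U, ∀ u v, Γ y u v = Γ y v u
  compat : ∀ y ∈ U, ∀ a u v, fderiv ℝ g y a u v = g y (Γ y a u) v + g y u (Γ y a v)
  ν_ζ : ∀ y ∈ U, ν y (ζ y) = -1
  g_ζ : ∀ y ∈ U, ∀ u, g y u (ζ y) = ν y u
  fderiv_ζ : ∀ y ∈ U, ∀ u, fderiv ℝ ζ y u = - u - ν y u • ζ y - Γ y u (ζ y)

namespace KenmotsuOn

variable {U : Set E} {Γ : E → E →L[ℝ] E →L[ℝ] E} {g : E → E →L[ℝ] E →L[ℝ] ℝ} {ζ K : E → E}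
  {ν : E → E →L[ℝ] ℝ} {y : E}

lemma ext_g (H : KenmotsuOn U g Γ ζ ν) (hy : y ∈ U) {u v : E} (h : ∀ w, g y u w = g y v w) :
    u = v :=
  sub_eq_zero.1 (H.nondeg y hy _ fun w => by simp [h w])

lemma ζ_g (H : KenmotsuOn U g Γ ζ ν) (hy : y ∈ U) (u : E) : g y (ζ y) u = ν y u := by
  rw [H.symm_g y hy, H.g_ζ y hy]

/-- This is `∇ν = -γ` with `γ = g + ν ⊗ ν`, the metric dual of the formula for `∇ζ`. -/
lemma fderiv_ν (H : KenmotsuOn U g Γ ζ ν) (hy : y ∈ U) (a v : E) :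
    fderiv ℝ ν y a v = ν y (Γ y a v) - g y a v - ν y a * ν y v := by
  have h0 := differentiableAt_of_mem H.isOpen H.smooth_g hy
  have h1 := differentiableAt_of_mem H.isOpen H.smooth_ζ hy
  have h2 := differentiableAt_of_mem H.isOpen H.smooth_ν hy
  rw [← fderiv_apply_const h2, fderiv_congr_on H.isOpen hy fun z hz => (H.g_ζ z hz v).symm,
    fderiv_apply_apply (by fun_prop) h1, fderiv_apply_const h0, H.compat y hy, H.fderiv_ζ y hy]
  simp only [map_sub, map_neg, map_smul, H.g_ζ y hy, smul_eq_mul, H.symm_g y hy v a]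
  ring

lemma fderiv_fderiv_ζ (H : KenmotsuOn U g Γ ζ ν) (hy : y ∈ U) (u v : E) :
    fderiv ℝ (fderiv ℝ ζ) y u v = - (fderiv ℝ ν y u v • ζ y + ν y v • fderiv ℝ ζ y u)
      - (fderiv ℝ Γ y u v (ζ y) + Γ y v (fderiv ℝ ζ y u)) := by
  have h0 := differentiableAt_of_mem H.isOpen H.smooth_Γ hy
  have h1 := differentiableAt_of_mem H.isOpen H.smooth_ζ hy
  have h2 := differentiableAt_of_mem H.isOpen H.smooth_ν hy
  have h3 := differentiableAt_of_mem H.isOpen (contDiffOn_fderiv H.isOpen H.smooth_ζ) hy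
  rw [← fderiv_apply_const h3, fderiv_congr_on H.isOpen hy fun z hz => H.fderiv_ζ z hz v]
  simp (disch := fun_prop) only [fderiv_sub_apply, fderiv_smul_apply, fderiv_apply_apply,
    fderiv_fun_const, Pi.zero_apply, _root_.zero_apply, map_zero, add_zero]
  abel

/-- The Ricci identity for `ζ`: antisymmetrise its second derivative and substitute the formulas for
`∇ζ` and `∇ν`. -/
lemma curv_ζ (H : KenmotsuOn U g Γ ζ ν) (hy : y ∈ U) (u v : E) :
    curv Γ y u v (ζ y) = ν y v • u - ν y u • v := by
  have h := fderiv_fderiv_comm H.isOpen H.smooth_ζ hy u v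
  simp only [H.fderiv_fderiv_ζ hy, H.fderiv_ν hy, H.fderiv_ζ y hy, map_sub, map_neg, map_smul,
    H.symm_g y hy v u, H.symm_Γ y hy v u] at h
  rw [curv_apply, ← sub_eq_zero]
  rw [← sub_eq_zero] at h
  rw [← neg_eq_zero, ← h]
  module

/-- Pair symmetry and skew-adjointness move `ζ` into the last slot, where `curv_ζ` applies. -/
lemma curv_ζ_right (H : KenmotsuOn U g Γ ζ ν) (hy : y ∈ U) (u w : E) :
    curv Γ y u (ζ y) w = ν y w • u - g y u w • ζ y := by
  refine H.ext_g hy fun z => ?_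
  rw [metric_curv_pair H.isOpen H.smooth_Γ H.smooth_g H.symm_Γ H.symm_g H.compat hy,
    metric_curv H.isOpen H.smooth_Γ H.smooth_g H.compat hy, H.curv_ζ hy]
  simp [H.ζ_g hy]
  ring

lemma lieBil_ζ (H : KenmotsuOn U g Γ ζ ν) (hy : y ∈ U) (u v : E) :
    lieBil ζ g y u v = (-2) * (g y u v + ν y u * ν y v) := by
  rw [lieBil_apply, H.compat y hy]
  simp only [H.fderiv_ζ y hy, map_sub, map_neg, map_smul, _root_.sub_apply, _root_.neg_apply,
    _root_.smul_apply, smul_eq_mul, H.ζ_g hy, H.g_ζ y hy, H.symm_Γ y hy (ζ y)]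
  ring

/-- Covariantly, `(∇_a γ)(u,v) = -γ(a,u)ν(v) - ν(u)γ(a,v)`. -/
lemma fderiv_γ (H : KenmotsuOn U g Γ ζ ν) (hy : y ∈ U) (a u v : E) :
    fderiv ℝ (fun z => g z u v + ν z u * ν z v) y a
      = (g y (Γ y a u) v + ν y (Γ y a u) * ν y v) + (g y u (Γ y a v) + ν y u * ν y (Γ y a v))
        - (g y a u + ν y a * ν y u) * ν y v - ν y u * (g y a v + ν y a * ν y v) := by
  have h0 := differentiableAt_of_mem H.isOpen H.smooth_g hy
  have h2 := differentiableAt_of_mem H.isOpen H.smooth_ν hy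
  rw [fderiv_add_apply (by fun_prop) (by fun_prop), fderiv_apply_const₂ h0,
    fderiv_mul_apply (by fun_prop) (by fun_prop), fderiv_apply_const h2, fderiv_apply_const h2,
    H.compat y hy, H.fderiv_ν hy, H.fderiv_ν hy]
  ring

section FiniteDim

variable [FiniteDimensional ℝ E]

lemma covBil_lieBil_ζ (H : KenmotsuOn U g Γ ζ ν) (hy : y ∈ U) (a u v : E) :
    covBil Γ (lieBil ζ g) y a u v = 2 * ((g y a u + ν y a * ν y u) * ν y v
      + ν y u * (g y a v + ν y a * ν y v)) := by
  have h0 := differentiableAt_of_mem H.isOpen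
    (contDiffOn_lieBil H.isOpen H.smooth_g H.smooth_ζ) hy
  have h1 := differentiableAt_of_mem H.isOpen H.smooth_g hy
  have h2 := differentiableAt_of_mem H.isOpen H.smooth_ν hy
  rw [covBil, ← fderiv_apply_const₂ h0,
    fderiv_congr_on H.isOpen hy fun z hz => H.lieBil_ζ hz u v,
    fderiv_mul_apply (by fun_prop) (by fun_prop), H.fderiv_γ hy, H.lieBil_ζ hy, H.lieBil_ζ hy]
  simp
  ring

/-- In the cyclic combination of `∇(£_ζ g) = -2∇γ` every term cancels except `4γ(u,v)ν(w)`. -/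
lemma lieConn_ζ (H : KenmotsuOn U g Γ ζ ν) (hy : y ∈ U) (u v : E) :
    lieConn Γ ζ y u v = (2 * (g y u v + ν y u * ν y v)) • ζ y := by
  refine H.ext_g hy fun w => ?_
  have h := metric_lieConn H.isOpen H.smooth_Γ H.smooth_g H.smooth_ζ H.symm_Γ H.symm_g H.compat
    hy u v w
  simp only [H.covBil_lieBil_ζ hy] at h
  simp only [map_smul, _root_.smul_apply, smul_eq_mul, H.ζ_g hy]
  rw [H.symm_g y hy v u, H.symm_g y hy w u, H.symm_g y hy w v] at h
  linarith

lemma covVec_lieConn_ζ (H : KenmotsuOn U g Γ ζ ν) (hy : y ∈ U) (a u v : E) :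
    covVec Γ (lieConn Γ ζ) y a u v = (-2 * ((g y a u + ν y a * ν y u) * ν y v
      + ν y u * (g y a v + ν y a * ν y v))) • ζ y
      - (2 * (g y u v + ν y u * ν y v)) • (a + ν y a • ζ y) := by
  have h0 := differentiableAt_of_mem H.isOpen
    (contDiffOn_lieConn H.isOpen H.smooth_Γ H.smooth_ζ) hy
  have h1 := differentiableAt_of_mem H.isOpen H.smooth_g hy
  have h2 := differentiableAt_of_mem H.isOpen H.smooth_ν hy
  have h3 := differentiableAt_of_mem H.isOpen H.smooth_ζ hy
  rw [covVec, ← fderiv_apply_const₂ h0,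
    fderiv_congr_on H.isOpen hy fun z hz => H.lieConn_ζ hz u v,
    fderiv_smul_apply (by fun_prop) (by fun_prop),
    fderiv_mul_apply (by fun_prop) (by fun_prop), H.fderiv_γ hy, H.fderiv_ζ y hy]
  simp only [H.lieConn_ζ hy, fderiv_fun_const, Pi.zero_apply, _root_.zero_apply, map_smul]
  module

/-- In `∇(£_ζ ∇)` the coefficient of `ζ` is symmetric in the first two arguments, so
antisymmetrising removes it. -/
lemma lieCurv_ζ (H : KenmotsuOn U g Γ ζ ν) (hy : y ∈ U) (u v w : E) :
    lieCurv ζ (curv Γ) y u v w = (2 * (g y u w + ν y u * ν y w)) • v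
      - (2 * (g y v w + ν y v * ν y w)) • u := by
  rw [lieCurv_curv H.isOpen H.smooth_Γ H.smooth_ζ H.symm_Γ hy, H.covVec_lieConn_ζ hy,
    H.covVec_lieConn_ζ hy, H.symm_g y hy v u]
  module

end FiniteDim

end KenmotsuOn

end FlatCalculus

/-! ### Traces, the Ricci tensor and the tensor `S - (n-1)g`. -/

namespace FlatCalculus

variable {E : Type*} [NormedAddCommGroup E] [NormedSpace ℝ E] [FiniteDimensional ℝ E]

open ContinuousLinearMap

set_option maxSynthPendingDepth 3

lemma fderiv_const_mul_apply {F : Type*} [NormedAddCommGroup F] [NormedSpace ℝ F] {f : F → ℝ}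
    {x : F} (hf : DifferentiableAt ℝ f x) (c : ℝ) (a : F) :
    fderiv ℝ (fun y => c * f y) x a = c * fderiv ℝ f x a := by
  rw [fderiv_const_mul hf]; rfl

/-- The trace of a continuous endomorphism. -/
noncomputable def tr : (E →L[ℝ] E) →L[ℝ] ℝ :=
  LinearMap.toContinuousLinearMap ((LinearMap.trace ℝ E).comp (ContinuousLinearMap.coeLM ℝ))

lemma tr_apply (f : E →L[ℝ] E) : tr f = LinearMap.trace ℝ E (f : E →ₗ[ℝ] E) := rfl

lemma tr_id : tr (ContinuousLinearMap.id ℝ E) = Module.finrank ℝ E :=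
  LinearMap.trace_id ℝ E

lemma tr_smulRight (f : E →L[ℝ] ℝ) (v : E) : tr (f.smulRight v) = f v :=
  LinearMap.trace_smulRight (f : E →ₗ[ℝ] ℝ) v

lemma tr_comp_comm (f h : E →L[ℝ] E) : tr (f.comp h) = tr (h.comp f) :=
  LinearMap.trace_mul_comm ℝ (f : E →ₗ[ℝ] E) (h : E →ₗ[ℝ] E)

/-- The contraction of a tensor of curvature type, `(v,w) ↦ tr (u ↦ R(u,v)w)`. -/
noncomputable def contr : (E →L[ℝ] E →L[ℝ] E →L[ℝ] E) →L[ℝ] (E →L[ℝ] E →L[ℝ] ℝ) :=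
  (compL ℝ E (E →L[ℝ] E →L[ℝ] E) (E →L[ℝ] ℝ)
    ((compL ℝ E (E →L[ℝ] E) ℝ tr).comp
      (flipₗᵢ ℝ E E E).toContinuousLinearEquiv.toContinuousLinearMap)).comp
      (flipₗᵢ ℝ E E (E →L[ℝ] E)).toContinuousLinearEquiv.toContinuousLinearMap

lemma contr_apply (R : E →L[ℝ] E →L[ℝ] E →L[ℝ] E) (v w : E) :
    contr R v w = tr ((R.flip v).flip w) := rfl

/-- The Ricci tensor of a connection. -/
noncomputable def ric (Γ : E → E →L[ℝ] E →L[ℝ] E) (y : E) : E →L[ℝ] E →L[ℝ] ℝ := contr (curv Γ y)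

lemma ric_eq_tr (Γ : E → E →L[ℝ] E →L[ℝ] E) (y v w : E) {L : E →L[ℝ] E}
    (hL : ∀ u, L u = curv Γ y u v w) : ric Γ y v w = tr L := by
  rw [ric, contr_apply]
  congr 1
  ext u
  simp [hL]

lemma contDiffOn_ric {U : Set E} (hU : IsOpen U) {Γ : E → E →L[ℝ] E →L[ℝ] E}
    (hΓ : ContDiffOn ℝ ∞ Γ U) : ContDiffOn ℝ ∞ (ric Γ) U :=
  (contr (E := E)).contDiff.comp_contDiffOn (contDiffOn_curv hU hΓ)

/-- The Lie derivative commutes with contraction: the terms `R(DX u,v)w` and `DX(R(u,v)w)` have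
equal traces in `u` and cancel. -/
lemma lieBil_ric {U : Set E} (hU : IsOpen U) {Γ : E → E →L[ℝ] E →L[ℝ] E}
    (hΓ : ContDiffOn ℝ ∞ Γ U) (X : E → E) {y : E} (hy : y ∈ U) (v w : E) {L : E →L[ℝ] E}
    (hL : ∀ u, L u = lieCurv X (curv Γ) y u v w) : lieBil X (ric Γ) y v w = tr L := by
  have h0 := differentiableAt_of_mem hU (contDiffOn_curv hU hΓ) hy
  -- Contraction is a fixed continuous linear map, so it commutes with differentiation.
  have h1 : fderiv ℝ (ric Γ) y (X y) = contr (fderiv ℝ (curv Γ) y (X y)) :=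
    fderiv_const_apply contr h0 _
  set R := curv Γ y with hR
  set X' := fderiv ℝ X y
  have hL' : L = ((fderiv ℝ (curv Γ) y (X y)).flip v).flip w + ((R.flip v).flip w).comp X'
      + (R.flip (X' v)).flip w + (R.flip v).flip (X' w) - X'.comp ((R.flip v).flip w) := by
    ext u
    simp [hL, lieCurv, R, X']
  rw [hL', map_sub, map_add, map_add, map_add, tr_comp_comm _ X', lieBil_apply, h1]
  simp only [ric, contr_apply]
  ring

namespace KenmotsuOn

variable {U : Set E} {Γ : E → E →L[ℝ] E →L[ℝ] E} {g : E → E →L[ℝ] E →L[ℝ] ℝ} {ζ K : E → E}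
  {ν : E → E →L[ℝ] ℝ} {y : E}

lemma ric_ζ_right (H : KenmotsuOn U g Γ ζ ν) (hy : y ∈ U) (v : E) :
    ric Γ y v (ζ y) = (Module.finrank ℝ E - 1) * ν y v := by
  rw [ric_eq_tr Γ y v (ζ y) (L := ν y v • ContinuousLinearMap.id ℝ E - (ν y).smulRight v)
    (fun u => by simp [H.curv_ζ hy]), map_sub, map_smul, tr_id, tr_smulRight, smul_eq_mul]
  ring

lemma ric_ζ_left (H : KenmotsuOn U g Γ ζ ν) (hy : y ∈ U) (v : E) :
    ric Γ y (ζ y) v = (Module.finrank ℝ E - 1) * ν y v := by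
  rw [ric_eq_tr Γ y (ζ y) v (L := ν y v • ContinuousLinearMap.id ℝ E - (g y v).smulRight (ζ y))
    (fun u => by simp [H.curv_ζ_right hy, H.symm_g y hy u v]), map_sub, map_smul, tr_id,
    tr_smulRight, H.g_ζ y hy, smul_eq_mul]
  ring

lemma lieBil_ζ_ric (H : KenmotsuOn U g Γ ζ ν) (hy : y ∈ U) (v w : E) :
    lieBil ζ (ric Γ) y v w
      = -2 * (Module.finrank ℝ E - 1) * (g y v w + ν y v * ν y w) := by
  rw [lieBil_ric H.isOpen H.smooth_Γ ζ hy v w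
    (L := (2 : ℝ) • (g y w + ν y w • ν y).smulRight v
      - (2 * (g y v w + ν y v * ν y w)) • ContinuousLinearMap.id ℝ E)
    (fun u => by simp [H.lieCurv_ζ hy, H.symm_g y hy u w, smul_smul, mul_comm]), map_sub, map_smul,
    map_smul, tr_id, tr_smulRight]
  simp [H.symm_g y hy w v]
  ring

/-- The tensor `S - (n-1) g`. -/
noncomputable def excess (g : E → E →L[ℝ] E →L[ℝ] ℝ) (Γ : E → E →L[ℝ] E →L[ℝ] E) (z : E) :
    E →L[ℝ] E →L[ℝ] ℝ := ric Γ z - ((Module.finrank ℝ E : ℝ) - 1) • g z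

lemma excess_apply (z u v : E) :
    excess g Γ z u v = ric Γ z u v - ((Module.finrank ℝ E : ℝ) - 1) * g z u v := rfl

lemma smooth_excess (H : KenmotsuOn U g Γ ζ ν) : ContDiffOn ℝ ∞ (excess g Γ) U :=
  (contDiffOn_ric H.isOpen H.smooth_Γ).sub (H.smooth_g.const_smul ((Module.finrank ℝ E : ℝ) - 1))

lemma fderiv_excess (H : KenmotsuOn U g Γ ζ ν) (hy : y ∈ U) (a u v : E) :
    fderiv ℝ (excess g Γ) y a u v = fderiv ℝ (ric Γ) y a u v
      - ((Module.finrank ℝ E : ℝ) - 1) * fderiv ℝ g y a u v := by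
  have h0 := differentiableAt_of_mem H.isOpen H.smooth_g hy
  have h1 := differentiableAt_of_mem H.isOpen (contDiffOn_ric H.isOpen H.smooth_Γ) hy
  have h2 := differentiableAt_of_mem H.isOpen H.smooth_excess hy
  rw [← fderiv_apply_const₂ h2]
  simp only [excess_apply]
  rw [fderiv_sub_apply (by fun_prop) (by fun_prop), fderiv_mul_apply (by fun_prop) (by fun_prop),
    fderiv_apply_const₂ h0, fderiv_apply_const₂ h1]
  simp

lemma excess_ζ_left (H : KenmotsuOn U g Γ ζ ν) (hy : y ∈ U) (v : E) :
    excess g Γ y (ζ y) v = 0 := by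
  rw [excess_apply, H.ric_ζ_left hy, H.ζ_g hy, sub_self]

lemma excess_ζ_right (H : KenmotsuOn U g Γ ζ ν) (hy : y ∈ U) (v : E) :
    excess g Γ y v (ζ y) = 0 := by
  rw [excess_apply, H.ric_ζ_right hy, H.g_ζ y hy, sub_self]

/-- Both `£_ζ S` and `(n-1) £_ζ g` equal `-2(n-1)γ`. -/
lemma lieBil_ζ_excess (H : KenmotsuOn U g Γ ζ ν) (hy : y ∈ U) (u v : E) :
    lieBil ζ (excess g Γ) y u v = 0 := by
  have h1 := H.lieBil_ζ hy u v
  have h2 := H.lieBil_ζ_ric hy u v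
  rw [lieBil_apply] at h1 h2 ⊢
  rw [H.fderiv_excess hy]
  simp only [excess_apply]
  linear_combination h2 - ((Module.finrank ℝ E : ℝ) - 1) * h1

/-- `∇_ζ` differs from `£_ζ` by the action of `∇ζ`. As `ζ` is in the kernel of the tensor, `∇ζ` acts
as `-1` on each slot, whence the factor 2. -/
lemma covBil_ζ_excess (H : KenmotsuOn U g Γ ζ ν) (hy : y ∈ U) (u v : E) :
    covBil Γ (excess g Γ) y (ζ y) u v = 2 * excess g Γ y u v := by
  have h1 := H.lieBil_ζ_excess hy u v
  rw [lieBil_apply] at h1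
  simp only [H.fderiv_ζ y hy, map_sub, map_neg, map_smul, _root_.sub_apply, _root_.neg_apply,
    _root_.smul_apply, smul_eq_mul, H.excess_ζ_left hy, H.excess_ζ_right hy] at h1
  rw [covBil, H.symm_Γ y hy (ζ y), H.symm_Γ y hy (ζ y)]
  linear_combination h1

/-- Differentiate `excess(ζ,v) = 0`; the derivative of `ζ` contributes `-a` modulo the kernel. -/
lemma covBil_excess_ζ_left (H : KenmotsuOn U g Γ ζ ν) (hy : y ∈ U) (a v : E) :
    covBil Γ (excess g Γ) y a (ζ y) v = excess g Γ y a v := by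
  have h0 := differentiableAt_of_mem H.isOpen H.smooth_excess hy
  have h1 := differentiableAt_of_mem H.isOpen H.smooth_ζ hy
  have h : fderiv ℝ (fun z => excess g Γ z (ζ z) v) y a = 0 := by
    rw [fderiv_congr_on H.isOpen hy fun z hz => H.excess_ζ_left hz v]
    simp
  rw [fderiv_apply_const (c := fun z => excess g Γ z (ζ z)) (by fun_prop),
    fderiv_apply_apply h0 h1, _root_.add_apply, H.fderiv_ζ y hy] at h
  simp only [map_sub, map_neg, map_smul, _root_.sub_apply, _root_.neg_apply,
    _root_.smul_apply, smul_eq_mul, H.excess_ζ_left hy] at h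
  rw [covBil, H.excess_ζ_left hy]
  linear_combination h

lemma covBil_excess_ζ_right (H : KenmotsuOn U g Γ ζ ν) (hy : y ∈ U) (a u : E) :
    covBil Γ (excess g Γ) y a u (ζ y) = excess g Γ y u a := by
  have h0 := differentiableAt_of_mem H.isOpen H.smooth_excess hy
  have h1 := differentiableAt_of_mem H.isOpen H.smooth_ζ hy
  have h : fderiv ℝ (fun z => excess g Γ z u (ζ z)) y a = 0 := by
    rw [fderiv_congr_on H.isOpen hy fun z hz => H.excess_ζ_right hz u]
    simp
  rw [fderiv_apply_apply (c := fun z => excess g Γ z u) (by fun_prop) h1, fderiv_apply_const h0,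
    H.fderiv_ζ y hy] at h
  simp only [map_sub, map_neg, map_smul, smul_eq_mul, H.excess_ζ_right hy] at h
  rw [covBil, H.excess_ζ_right hy]
  linear_combination h

/-! ### The endomorphism `T` that represents `S - (n-1)g`, and its trace. -/

variable {T : E → E →L[ℝ] E}

lemma T_ζ (H : KenmotsuOn U g Γ ζ ν) (hT : ∀ z ∈ U, ∀ u v, g z (T z u) v = excess g Γ z u v)
    (hy : y ∈ U) : T y (ζ y) = 0 :=
  H.nondeg y hy _ fun v => by rw [hT y hy, H.excess_ζ_left hy]

lemma ν_T (H : KenmotsuOn U g Γ ζ ν) (hT : ∀ z ∈ U, ∀ u v, g z (T z u) v = excess g Γ z u v)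
    (hy : y ∈ U) (u : E) : ν y (T y u) = 0 := by
  rw [← H.g_ζ y hy, hT y hy, H.excess_ζ_right hy]

/-- This is `£_ζ T = 2T`. Lowering the index with `g` gives an invariant tensor, so `£_ζ T` only
compensates `£_ζ g = -2γ`, and `γ(Tu,v) = g(Tu,v)` because `ν ∘ T = 0`. -/
lemma fderiv_T_ζ (H : KenmotsuOn U g Γ ζ ν)
    (hT : ∀ z ∈ U, ∀ u v, g z (T z u) v = excess g Γ z u v) (hTs : ContDiffOn ℝ ∞ T U)
    (hy : y ∈ U) (u : E) :
    fderiv ℝ T y (ζ y) u = (2 : ℝ) • T y u - T y (fderiv ℝ ζ y u) + fderiv ℝ ζ y (T y u) := by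
  have h0 := differentiableAt_of_mem H.isOpen H.smooth_excess hy
  have h1 := differentiableAt_of_mem H.isOpen H.smooth_g hy
  have h2 := differentiableAt_of_mem H.isOpen hTs hy
  refine H.ext_g hy fun v => ?_
  have e1 := H.lieBil_ζ_excess hy u v
  have e2 := H.lieBil_ζ hy (T y u) v
  have e3 : fderiv ℝ (excess g Γ) y (ζ y) u v
      = fderiv ℝ g y (ζ y) (T y u) v + g y (fderiv ℝ T y (ζ y) u) v := by
    rw [← fderiv_apply_const₂ h0, fderiv_congr_on H.isOpen hy fun z hz => (hT z hz u v).symm]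
    rw [fderiv_apply_const (c := fun z => g z (T z u)) (by fun_prop),
      fderiv_apply_apply h1 (by fun_prop), fderiv_apply_const h2]
    rfl
  rw [lieBil_apply, e3, ← hT y hy, ← hT y hy] at e1
  rw [lieBil_apply, H.ν_T hT hy] at e2
  simp only [map_sub, map_add, map_smul, _root_.sub_apply, _root_.add_apply, _root_.smul_apply,
    smul_eq_mul]
  linear_combination e1 - e2

/-- If the trace of `S - (n-1) g` is constant then it vanishes. -/
lemma tr_T_eq_zero (H : KenmotsuOn U g Γ ζ ν)
    (hT : ∀ z ∈ U, ∀ u v, g z (T z u) v = excess g Γ z u v) (hTs : ContDiffOn ℝ ∞ T U)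
    {k : ℝ} (hk : ∀ z ∈ U, tr (T z) = k) (hy : y ∈ U) : k = 0 := by
  have h2 := differentiableAt_of_mem H.isOpen hTs hy
  have h : fderiv ℝ (fun z => tr (T z)) y (ζ y) = 0 := by
    rw [fderiv_congr_on H.isOpen hy hk]
    simp
  have e : fderiv ℝ T y (ζ y) = (2 : ℝ) • T y - (T y).comp (fderiv ℝ ζ y)
      + (fderiv ℝ ζ y).comp (T y) := by
    ext u
    simp [H.fderiv_T_ζ hT hTs hy]
  -- The commutator of `T` with the derivative of `ζ` is traceless, so what remains is `0 = 2k`.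
  rw [fderiv_const_apply tr h2, e, map_add, map_sub, tr_comp_comm, map_smul, hk y hy] at h
  simpa using h

/-! ### The soliton equation on an LP-Kenmotsu structure. -/

section Soliton

variable {σ f : ℝ}

/-- `£_K g` is `-2σ` times `S - (n-1)g` plus a constant multiple of the parallel tensor `g`;
constancy of `f` is essential. -/
lemma covBil_lieBil_soliton (H : KenmotsuOn U g Γ ζ ν) (hKs : ContDiffOn ℝ ∞ K U)
    (hK : ∀ z ∈ U, ∀ u v, lieBil K g z u v + 2 * σ * ric Γ z u v + f * g z u v = 0)
    (hy : y ∈ U) (a u v : E) :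
    covBil Γ (lieBil K g) y a u v = -2 * σ * covBil Γ (excess g Γ) y a u v := by
  have h0 := differentiableAt_of_mem H.isOpen H.smooth_excess hy
  have h1 := differentiableAt_of_mem H.isOpen H.smooth_g hy
  have h2 := differentiableAt_of_mem H.isOpen (contDiffOn_lieBil H.isOpen H.smooth_g hKs) hy
  have hK' : ∀ z ∈ U, ∀ u v, lieBil K g z u v = -2 * σ * excess g Γ z u v
      - (2 * σ * ((Module.finrank ℝ E : ℝ) - 1) + f) * g z u v := fun z hz u v => by
    rw [excess_apply]
    linear_combination hK z hz u v
  rw [covBil, covBil, ← fderiv_apply_const₂ h2, fderiv_congr_on H.isOpen hy fun z hz => hK' z hz u v,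
    fderiv_sub_apply (by fun_prop) (by fun_prop), fderiv_const_mul_apply (by fun_prop),
    fderiv_const_mul_apply (by fun_prop), fderiv_apply_const₂ h0, fderiv_apply_const₂ h1,
    hK' y hy, hK' y hy, H.compat y hy]
  simp
  ring

/-- The three covariant derivatives in `metric_lieConn` contribute `1 + 2 - 1 = 2` copies of
`excess(u,w)`. -/
lemma lieConn_soliton (H : KenmotsuOn U g Γ ζ ν) (hKs : ContDiffOn ℝ ∞ K U)
    (hK : ∀ z ∈ U, ∀ u v, lieBil K g z u v + 2 * σ * ric Γ z u v + f * g z u v = 0)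
    (hT : ∀ z ∈ U, ∀ u v, g z (T z u) v = excess g Γ z u v)
    (hy : y ∈ U) (u : E) : lieConn Γ K y u (ζ y) = (-2 * σ) • T y u := by
  refine H.ext_g hy fun w => ?_
  have h := metric_lieConn H.isOpen H.smooth_Γ H.smooth_g hKs H.symm_Γ H.symm_g H.compat
    hy u (ζ y) w
  simp only [H.covBil_lieBil_soliton hKs hK hy, H.covBil_excess_ζ_left hy, H.covBil_ζ_excess hy,
    H.covBil_excess_ζ_right hy] at h
  simp only [map_smul, _root_.smul_apply, smul_eq_mul, hT y hy]
  linarith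

/-- Put `A = £_K ∇`. From `A(ζ,ζ) = 0` comes `(∇_u A)(ζ,ζ) = -2A(∇_u ζ,ζ) = -4σ T u`. From `∇_ζ ζ =
0` and `∇_ζ T = 2T` comes `(∇_ζ A)(u,ζ) = -4σ T u`. The two cancel in `lieCurv_curv`. -/
lemma lieCurv_soliton (H : KenmotsuOn U g Γ ζ ν) (hKs : ContDiffOn ℝ ∞ K U)
    (hK : ∀ z ∈ U, ∀ u v, lieBil K g z u v + 2 * σ * ric Γ z u v + f * g z u v = 0)
    (hT : ∀ z ∈ U, ∀ u v, g z (T z u) v = excess g Γ z u v) (hTs : ContDiffOn ℝ ∞ T U)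
    (hy : y ∈ U) (u : E) : lieCurv K (curv Γ) y u (ζ y) (ζ y) = 0 := by
  have h0 := differentiableAt_of_mem H.isOpen
    (contDiffOn_lieConn H.isOpen H.smooth_Γ hKs) hy
  have h1 := differentiableAt_of_mem H.isOpen H.smooth_ζ hy
  have h2 := differentiableAt_of_mem H.isOpen hTs hy
  have hA := fun z (hz : z ∈ U) => H.lieConn_soliton hKs hK hT hz
  have hAs := lieConn_symm H.isOpen H.smooth_Γ hKs H.symm_Γ hy
  have d1 : fderiv ℝ (fun z => lieConn Γ K z (ζ z) (ζ z)) y u = 0 := by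
    rw [fderiv_congr_on H.isOpen hy fun z hz => (by rw [hA z hz, H.T_ζ hT hz, smul_zero] :
      lieConn Γ K z (ζ z) (ζ z) = 0)]
    simp
  have d2 : fderiv ℝ (fun z => lieConn Γ K z u (ζ z)) y (ζ y)
      = (-2 * σ) • fderiv ℝ T y (ζ y) u := by
    rw [fderiv_congr_on H.isOpen hy fun z hz => hA z hz u,
      fderiv_smul_apply (by fun_prop) (by fun_prop), fderiv_apply_const h2]
    simp
  rw [fderiv_apply_apply (c := fun z => lieConn Γ K z (ζ z)) (by fun_prop) h1,
    fderiv_apply_apply h0 h1, _root_.add_apply] at d1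
  rw [fderiv_apply_apply (c := fun z => lieConn Γ K z u) (by fun_prop) h1,
    fderiv_apply_const h0, H.fderiv_T_ζ hT hTs hy] at d2
  rw [lieCurv_curv H.isOpen H.smooth_Γ hKs H.symm_Γ hy]
  simp only [H.fderiv_ζ y hy, map_sub, map_neg, map_smul, _root_.sub_apply, _root_.neg_apply,
    _root_.smul_apply, hA y hy, hAs (ζ y), H.T_ζ hT hy, H.ν_T hT hy, H.ν_ζ y hy, smul_zero,
    zero_smul, sub_zero] at d1 d2
  simp only [covVec, hA y hy, hAs (ζ y), H.T_ζ hT hy, map_smul, map_zero, smul_zero, add_zero,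
    _root_.smul_apply, H.symm_Γ y hy (ζ y)]
  rw [eq_sub_of_add_eq (eq_sub_of_add_eq d1), eq_sub_of_add_eq d2]
  module

/-- The constants of a soliton with constant scalar curvature. -/
theorem soliton_constant (H : KenmotsuOn U g Γ ζ ν) (hKs : ContDiffOn ℝ ∞ K U)
    (hK : ∀ z ∈ U, ∀ u v, lieBil K g z u v + 2 * σ * ric Γ z u v + f * g z u v = 0)
    (hT : ∀ z ∈ U, ∀ u v, g z (T z u) v = excess g Γ z u v) (hTs : ContDiffOn ℝ ∞ T U)
    (hy : y ∈ U) (hn : 2 ≤ Module.finrank ℝ E) :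
    f = -2 * σ * ((Module.finrank ℝ E : ℝ) - 1) := by
  have h0 := differentiableAt_of_mem H.isOpen H.smooth_g hy
  have h1 := differentiableAt_of_mem H.isOpen H.smooth_ζ hy
  have h2 := differentiableAt_of_mem H.isOpen H.smooth_ν hy
  have h3 := differentiableAt_of_mem H.isOpen (contDiffOn_curv H.isOpen H.smooth_Γ) hy
  -- `w` is the bracket `[K,ζ] = £_K ζ`.
  set w := fderiv ℝ ζ y (K y) - fderiv ℝ K y (ζ y) with hw
  -- The Lie derivative along `K` of `R(u,ζ)ζ = -(u + ν(u)ζ)`. With `£_K R` contributing nothing,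
  -- only `R(u,w)ζ + R(u,ζ)w` is left on the curvature side; the coefficient of `ζ` is `g(u,w) -
  -- (£_K ν)(u)`.
  have key : ∀ u, (2 * ν y w) • u = (g y u w - fderiv ℝ ν y (K y) u - ν y (fderiv ℝ K y u)) • ζ y := by
    intro u
    have e : fderiv ℝ (fun z => curv Γ z u (ζ z) (ζ z)) y (K y)
        = - (fderiv ℝ ν y (K y) u • ζ y + ν y u • fderiv ℝ ζ y (K y)) := by
      rw [fderiv_congr_on H.isOpen hy fun z hz => (by
          rw [H.curv_ζ hz, H.ν_ζ z hz]; module :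
            curv Γ z u (ζ z) (ζ z) = - (u + ν z u • ζ z)),
        fderiv_neg_apply, fderiv_add_apply (by fun_prop) (by fun_prop),
        fderiv_smul_apply (by fun_prop) (by fun_prop), fderiv_apply_const h2]
      simp
    rw [fderiv_apply_apply (c := fun z => curv Γ z u (ζ z)) (by fun_prop) h1,
      fderiv_apply_apply (c := fun z => curv Γ z u) (by fun_prop) h1, fderiv_apply_const h3,
      _root_.add_apply] at e
    have l := H.lieCurv_soliton hKs hK hT hTs hy u
    have hζ : fderiv ℝ ζ y (K y) = w + fderiv ℝ K y (ζ y) := by rw [hw]; abel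
    rw [hζ] at e
    simp only [lieCurv, map_add, map_sub, map_smul, _root_.add_apply, H.curv_ζ hy, H.curv_ζ_right hy, H.ν_ζ y hy]
      at l e
    rw [eq_sub_of_add_eq (eq_sub_of_add_eq e)] at l
    rw [← sub_eq_zero, ← neg_eq_zero, ← l]
    module
  have hν : ν y w = 0 := by
    -- If `ker ν` were zero, `ν` would embed the space in `ℝ`, against dimension at least 2. For
    -- such `u`, applying `ν` to `key` kills the coefficient of `ζ`, so `2ν(w)u = 0`.
    obtain ⟨u, hu, hu0⟩ : ∃ u ∈ LinearMap.ker (ν y : E →ₗ[ℝ] ℝ), u ≠ 0 := by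
      refine Submodule.exists_mem_ne_zero_of_ne_bot fun hb => ?_
      have := LinearMap.finrank_le_finrank_of_injective (LinearMap.ker_eq_bot.1 hb)
      simp at this
      omega
    have k := key u
    have k2 := congrArg (ν y) k
    have hu' : ν y u = 0 := hu
    simp only [map_smul, hu', H.ν_ζ y hy, smul_eq_mul] at k2
    rw [show g y u w - fderiv ℝ ν y (K y) u - ν y (fderiv ℝ K y u) = 0 by linarith, zero_smul] at k
    simpa [hu0] using k
  -- Constancy of `g(ζ,ζ)` along `K` gives `(£_K g)(ζ,ζ) = -2ν(w) = 0`, to be inserted in the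
  -- soliton equation on `(ζ,ζ)`.
  have e : fderiv ℝ (fun z => g z (ζ z) (ζ z)) y (K y) = 0 := by
    rw [fderiv_congr_on H.isOpen hy fun z hz => (by rw [H.g_ζ z hz, H.ν_ζ z hz] :
            g z (ζ z) (ζ z) = -1)]
    simp
  rw [fderiv_apply_apply (c := fun z => g z (ζ z)) (by fun_prop) h1,
      fderiv_apply_apply h0 h1, _root_.add_apply] at e
  have k := hK y hy (ζ y) (ζ y)
  rw [lieBil_apply, H.ric_ζ_left hy] at k
  simp only [H.g_ζ y hy, H.ζ_g hy, H.ν_ζ y hy] at e k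
  rw [hw, map_sub] at hν
  linear_combination -k + e - 2 * hν

end Soliton

end KenmotsuOn

end FlatCalculus

/-! ## Translation from index notation -/

namespace LocalGeom

open FlatCalculus ContinuousLinearMap

set_option maxSynthPendingDepth 3

variable {n : ℕ}

/-- The coordinate space. -/
abbrev Vec (n : ℕ) := EuclideanSpace ℝ (Fin n)

/-- The standard basis vector. -/
noncomputable def bvec (i : Fin n) : Vec n := EuclideanSpace.single i 1

lemma bvec_apply (i k : Fin n) : (bvec i : Vec n) k = if k = i then 1 else 0 := by
  simp [bvec]

lemma sum_bvec (v : Vec n) : ∑ i, v i • (bvec i : Vec n) = v := by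
  ext k
  simp [bvec_apply]

/-- Used to pass from index identities to identities of multilinear maps, one argument at a time. -/
lemma bvec_induction {p : Vec n → Prop} (hadd : ∀ u v, p u → p v → p (u + v))
    (hsmul : ∀ (c : ℝ) v, p v → p (c • v)) (h : ∀ i, p (bvec i)) (h0 : p 0) (v : Vec n) : p v := by
  rw [← sum_bvec v]
  exact Finset.sum_induction _ p hadd h0 fun i _ => hsmul _ _ (h i)

lemma clm_apply_eq_sum {F : Type*} [NormedAddCommGroup F] [NormedSpace ℝ F] (f : Vec n →L[ℝ] F)
    (v : Vec n) : f v = ∑ i, v i • f (bvec i) := by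
  conv_lhs => rw [← sum_bvec v]
  simp

lemma tr_eq_sum (f : Vec n →L[ℝ] Vec n) : tr f = ∑ i, f (bvec i) i := by
  rw [tr_apply, LinearMap.trace_eq_matrix_trace ℝ (EuclideanSpace.basisFun (Fin n) ℝ).toBasis,
    Matrix.trace]
  refine Finset.sum_congr rfl fun i _ => ?_
  rw [Matrix.diag_apply, LinearMap.toMatrix_apply]
  simp [bvec]

/-- The matrix of a bilinear form. -/
noncomputable def coordMat (g : Vec n → Vec n →L[ℝ] Vec n →L[ℝ] ℝ) (y : Vec n) : Matrix (Fin n) (Fin n) ℝ :=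
  Matrix.of fun i j => g y (bvec i) (bvec j)

/-- The Levi-Civita connection of `g` as a bilinear map. -/
noncomputable def levi (g : Vec n → Vec n →L[ℝ] Vec n →L[ℝ] ℝ) (y : Vec n) : Vec n →L[ℝ] Vec n →L[ℝ] Vec n :=
  ∑ k, ∑ i, ∑ j, christoffel (coordMat g) k i j y •
    (EuclideanSpace.proj i : Vec n →L[ℝ] ℝ).smulRight
      ((EuclideanSpace.proj j : Vec n →L[ℝ] ℝ).smulRight (bvec k : Vec n))

lemma levi_bvec (g : Vec n → Vec n →L[ℝ] Vec n →L[ℝ] ℝ) (y : Vec n) (i j k : Fin n) :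
    levi g y (bvec i) (bvec j) k = christoffel (coordMat g) k i j y := by
  simp [levi, bvec_apply]

lemma contDiffOn_det {F : Type*} [NormedAddCommGroup F] [NormedSpace ℝ F] {U : Set F}
    {A : F → Matrix (Fin n) (Fin n) ℝ} (hA : ∀ i j, ContDiffOn ℝ ∞ (fun z => A z i j) U) :
    ContDiffOn ℝ ∞ (fun z => (A z).det) U := by
  simp only [Matrix.det_apply]
  exact ContDiffOn.sum fun s _ => (contDiffOn_prod fun i _ => hA _ _).const_smul _

/-- Cramer's rule: entries of the inverse are polynomials in the entries divided by the determinant.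
-/
lemma contDiffOn_inv {F : Type*} [NormedAddCommGroup F] [NormedSpace ℝ F] {U : Set F}
    {A : F → Matrix (Fin n) (Fin n) ℝ} (hA : ∀ i j, ContDiffOn ℝ ∞ (fun z => A z i j) U)
    (hd : ∀ z ∈ U, (A z).det ≠ 0) (i j : Fin n) : ContDiffOn ℝ ∞ (fun z => (A z)⁻¹ i j) U := by
  simp only [Matrix.inv_def, Ring.inverse_eq_inv', Matrix.smul_apply, Matrix.adjugate_apply,
    smul_eq_mul]
  refine ((contDiffOn_det hA).inv hd).mul (contDiffOn_det fun k l => ?_)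
  simp only [Matrix.updateRow_apply]
  split_ifs
  · exact contDiffOn_const
  · exact hA _ _

section Metric

variable {U : Set (Vec n)} {g : Vec n → Vec n →L[ℝ] Vec n →L[ℝ] ℝ} {y : Vec n}

lemma coordMat_apply (i j : Fin n) : coordMat g y i j = g y (bvec i) (bvec j) := rfl

lemma pd_eq (i : Fin n) (f : Vec n → ℝ) : pd i f y = fderiv ℝ f y (bvec i) := rfl

lemma pd_apply {f : Vec n → Vec n} (hf : DifferentiableAt ℝ f y) (i k : Fin n) :
    pd i (fun z => f z k) y = fderiv ℝ f y (bvec i) k :=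
  fderiv_const_apply (EuclideanSpace.proj k : Vec n →L[ℝ] ℝ) hf (bvec i)

lemma pd_coordMat (hU : IsOpen U) (hg : ContDiffOn ℝ ∞ g U) (hy : y ∈ U) (i j k : Fin n) :
    pd i (fun z => coordMat g z j k) y = fderiv ℝ g y (bvec i) (bvec j) (bvec k) :=
  fderiv_apply_const₂ (differentiableAt_of_mem hU hg hy) (bvec j) (bvec k) (bvec i)

lemma contDiffOn_coordMat (hg : ContDiffOn ℝ ∞ g U) (i j : Fin n) :
    ContDiffOn ℝ ∞ (fun z => coordMat g z i j) U :=
  (hg.clm_apply contDiffOn_const).clm_apply contDiffOn_const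

lemma det_coordMat_ne_zero (hn : ∀ u, (∀ v, g y u v = 0) → u = 0) : (coordMat g y).det ≠ 0 := by
  intro h
  obtain ⟨v, hv, hv0⟩ := Matrix.exists_vecMul_eq_zero_iff.2 h
  refine hv ?_
  have := hn (WithLp.toLp 2 v) fun w => ?_
  · ext i
    simpa using congrArg (fun x : Vec n => x.ofLp i) this
  · rw [clm_apply_eq_sum (g y _) w]
    refine Finset.sum_eq_zero fun j _ => ?_
    have e := congrFun hv0 j
    rw [clm_apply_eq_sum (g y)]
    simp only [Matrix.vecMul, dotProduct, coordMat_apply, Pi.zero_apply] at e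
    simp [_root_.sum_apply, e]

lemma coordMat_transpose (hs : ∀ u v, g y u v = g y v u) : (coordMat g y).transpose = coordMat g y := by
  ext i j
  exact hs _ _

lemma sum_inv_mul (hs : ∀ u v, g y u v = g y v u) (hn : ∀ u, (∀ v, g y u v = 0) → u = 0)
    (l m : Fin n) :
    ∑ k, (coordMat g y)⁻¹ k l * coordMat g y k m = if l = m then 1 else 0 := by
  have h : ((coordMat g y)⁻¹.transpose * coordMat g y) l m = (1 : Matrix (Fin n) (Fin n) ℝ) l m := by
    rw [Matrix.transpose_nonsing_inv, coordMat_transpose hs,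
      Matrix.nonsing_inv_mul _ (isUnit_iff_ne_zero.2 (det_coordMat_ne_zero hn))]
  simpa [Matrix.mul_apply, Matrix.one_apply] using h

lemma contDiffOn_levi (hU : IsOpen U) (hg : ContDiffOn ℝ ∞ g U)
    (hn : ∀ z ∈ U, ∀ u, (∀ v, g z u v = 0) → u = 0) : ContDiffOn ℝ ∞ (levi g) U := by
  have h1 := contDiffOn_inv (contDiffOn_coordMat hg) fun z hz => det_coordMat_ne_zero (hn z hz)
  have h2 : ∀ i j k, ContDiffOn ℝ ∞ (fun z => pd i (fun x => coordMat g x j k) z) U :=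
    fun i j k => (contDiffOn_fderiv hU (contDiffOn_coordMat hg j k)).clm_apply contDiffOn_const
  unfold levi
  refine ContDiffOn.sum fun k _ => ContDiffOn.sum fun i _ => ContDiffOn.sum fun j _ =>
    ContDiffOn.fun_smul ?_ contDiffOn_const
  unfold christoffel
  exact contDiffOn_const.mul (ContDiffOn.sum fun l _ => (h1 k l).mul
    (((h2 _ _ _).add (h2 _ _ _)).sub (h2 _ _ _)))

lemma christoffel_symm (hs : ∀ z ∈ U, ∀ u v, g z u v = g z v u) (hU : IsOpen U) (hy : y ∈ U)
    (k i j : Fin n) :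
    christoffel (coordMat g) k i j y = christoffel (coordMat g) k j i y := by
  have h : ∀ l, pd l (fun z => coordMat g z i j) y = pd l (fun z => coordMat g z j i) y := fun l => by
    rw [pd_eq, pd_eq, fderiv_congr_on hU hy (f := fun z => coordMat g z i j)
      (h := fun z => coordMat g z j i) fun z hz => hs z hz (bvec i) (bvec j)]
  simp only [christoffel, h]
  congr 1
  exact Finset.sum_congr rfl fun l _ => by ring

lemma levi_symm (hs : ∀ z ∈ U, ∀ u v, g z u v = g z v u) (hU : IsOpen U) (hy : y ∈ U) (u v : Vec n) :
    levi g y u v = levi g y v u := by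
  refine bvec_induction (p := fun u => levi g y u v = levi g y v u) ?_ ?_ ?_ (by simp) u
  · intro a b ha hb; simp [ha, hb]
  · intro c a ha; simp [ha]
  intro i
  refine bvec_induction (p := fun v => levi g y (bvec i) v = levi g y v (bvec i)) ?_ ?_ ?_
    (by simp) v
  · intro a b ha hb; simp [ha, hb]
  · intro c a ha; simp [ha]
  intro j
  ext k
  rw [levi_bvec, levi_bvec, christoffel_symm hs hU hy]

/-- The Koszul formula on coordinate fields: contracting the Christoffel symbols with `g` cancels
the inverse matrix. -/
lemma metric_levi_bvec (hU : IsOpen U) (hg : ContDiffOn ℝ ∞ g U)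
    (hs : ∀ z ∈ U, ∀ u v, g z u v = g z v u)
    (hn : ∀ z ∈ U, ∀ u, (∀ v, g z u v = 0) → u = 0) (hy : y ∈ U) (i j m : Fin n) :
    g y (levi g y (bvec i) (bvec j)) (bvec m) = (1 / 2) *
      (fderiv ℝ g y (bvec i) (bvec j) (bvec m) + fderiv ℝ g y (bvec j) (bvec i) (bvec m)
        - fderiv ℝ g y (bvec m) (bvec i) (bvec j)) := by
  rw [clm_apply_eq_sum (g y)]
  simp only [_root_.sum_apply, _root_.smul_apply, smul_eq_mul, levi_bvec, christoffel,
    pd_coordMat hU hg hy, ← coordMat_apply (g := g) (y := y)]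
  simp only [mul_assoc, Finset.sum_mul, ← Finset.mul_sum]
  rw [Finset.sum_comm]
  congr 1
  have : ∀ l k, (coordMat g y)⁻¹ k l * ((fderiv ℝ g y (bvec i) (bvec j) (bvec l)
      + fderiv ℝ g y (bvec j) (bvec i) (bvec l) - fderiv ℝ g y (bvec l) (bvec i) (bvec j))
      * coordMat g y k m) = (fderiv ℝ g y (bvec i) (bvec j) (bvec l)
      + fderiv ℝ g y (bvec j) (bvec i) (bvec l) - fderiv ℝ g y (bvec l) (bvec i) (bvec j)) *
      ((coordMat g y)⁻¹ k l * coordMat g y k m) := fun l k => by ring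
  simp only [this, ← Finset.mul_sum, sum_inv_mul (hs y hy) (hn y hy)]
  simp

lemma metric_levi_compat (hU : IsOpen U) (hg : ContDiffOn ℝ ∞ g U)
    (hs : ∀ z ∈ U, ∀ u v, g z u v = g z v u)
    (hn : ∀ z ∈ U, ∀ u, (∀ v, g z u v = 0) → u = 0) (hy : y ∈ U) (a u v : Vec n) :
    fderiv ℝ g y a u v = g y (levi g y a u) v + g y u (levi g y a v) := by
  have hds := fderiv_symm hU hg hs hy
  refine bvec_induction (p := fun a => fderiv ℝ g y a u v
    = g y (levi g y a u) v + g y u (levi g y a v)) ?_ ?_ ?_ (by simp) a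
  · intro a b ha hb; simp [ha, hb]; ring
  · intro c a ha; simp [ha]; ring
  intro i
  refine bvec_induction (p := fun u => fderiv ℝ g y (bvec i) u v
    = g y (levi g y (bvec i) u) v + g y u (levi g y (bvec i) v)) ?_ ?_ ?_ (by simp) u
  · intro a b ha hb; simp [ha, hb]; ring
  · intro c a ha; simp [ha]; ring
  intro j
  refine bvec_induction (p := fun v => fderiv ℝ g y (bvec i) (bvec j) v
    = g y (levi g y (bvec i) (bvec j)) v + g y (bvec j) (levi g y (bvec i) v)) ?_ ?_ ?_ (by simp) v
  · intro a b ha hb; simp [ha, hb]; ring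
  · intro c a ha; simp [ha]; ring
  intro k
  rw [hs y hy (bvec j), metric_levi_bvec hU hg hs hn hy, metric_levi_bvec hU hg hs hn hy,
    hds (bvec i) (bvec k) (bvec j)]
  ring

end Metric

end LocalGeom

/-! ### Index formulas for curvature, Ricci tensor and Lie derivative; the theorem in coordinates.
-/

namespace LocalGeom

open FlatCalculus ContinuousLinearMap

set_option maxSynthPendingDepth 3

variable {n : ℕ} {U : Set (Vec n)} {g : Vec n → Vec n →L[ℝ] Vec n →L[ℝ] ℝ} {y : Vec n}

lemma curvature_eq (hU : IsOpen U) (hΓ : ContDiffOn ℝ ∞ (levi g) U) (hy : y ∈ U)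
    (l i j k : Fin n) :
    curvature (coordMat g) l i j k y = curv (levi g) y (bvec i) (bvec j) (bvec k) l := by
  have h0 := differentiableAt_of_mem hU hΓ hy
  have h1 : ∀ a b c, pd a (christoffel (coordMat g) l b c) y
      = fderiv ℝ (levi g) y (bvec a) (bvec b) (bvec c) l := fun a b c => by
    have e : christoffel (coordMat g) l b c = fun z => levi g z (bvec b) (bvec c) l :=
      funext fun z => (levi_bvec g z b c l).symm
    rw [e, pd_apply (f := fun z => levi g z (bvec b) (bvec c)) (by fun_prop),
      fderiv_apply_const₂ h0]
  have h2 : ∀ a b c, (levi g y (bvec a) (levi g y (bvec b) (bvec c))) l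
      = ∑ m, christoffel (coordMat g) l a m y * christoffel (coordMat g) m b c y :=
    fun a b c => by
      rw [clm_apply_eq_sum (levi g y (bvec a))]
      simp [levi_bvec, mul_comm]
  rw [curvature, h1, h1, curv_apply, Finset.sum_sub_distrib, ← h2, ← h2]
  simp
  ring

lemma ricci_eq (hU : IsOpen U) (hΓ : ContDiffOn ℝ ∞ (levi g) U) (hy : y ∈ U) (j k : Fin n) :
    ricci (coordMat g) j k y = ric (levi g) y (bvec j) (bvec k) := by
  rw [ric, contr_apply, tr_eq_sum, ricci]
  exact Finset.sum_congr rfl fun i _ => curvature_eq hU hΓ hy i i j k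

/-- The endomorphism corresponding to a bilinear form. -/
noncomputable def raise (g h : Vec n → Vec n →L[ℝ] Vec n →L[ℝ] ℝ) (y : Vec n) :
    Vec n →L[ℝ] Vec n :=
  ∑ k, ∑ l, (coordMat g y)⁻¹ k l • ((h y).flip (bvec l)).smulRight (bvec k)

lemma raise_apply (g h : Vec n → Vec n →L[ℝ] Vec n →L[ℝ] ℝ) (y u : Vec n) :
    raise g h y u = ∑ k, ∑ l, ((coordMat g y)⁻¹ k l * h y u (bvec l)) • (bvec k : Vec n) := by
  simp [raise, smul_smul]

lemma metric_raise (hs : ∀ u v, g y u v = g y v u) (hn : ∀ u, (∀ v, g y u v = 0) → u = 0)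
    (h : Vec n → Vec n →L[ℝ] Vec n →L[ℝ] ℝ) (u v : Vec n) :
    g y (raise g h y u) v = h y u v := by
  refine bvec_induction (p := fun v => g y (raise g h y u) v = h y u v) ?_ ?_ ?_ (by simp) v
  · intro a b ha hb; simp [ha, hb]
  · intro c a ha; simp [ha]
  intro m
  rw [raise_apply, Finset.sum_comm]
  simp only [map_sum, map_smul, _root_.sum_apply, _root_.smul_apply, smul_eq_mul,
    ← coordMat_apply (g := g) (y := y)]
  have : ∀ l k, (coordMat g y)⁻¹ k l * h y u (bvec l) * coordMat g y k m
      = h y u (bvec l) * ((coordMat g y)⁻¹ k l * coordMat g y k m) := fun l k => by ring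
  simp only [this, ← Finset.mul_sum, sum_inv_mul hs hn]
  simp

lemma tr_raise (g h : Vec n → Vec n →L[ℝ] Vec n →L[ℝ] ℝ) (y : Vec n) :
    tr (raise g h y) = ∑ k, ∑ l, (coordMat g y)⁻¹ k l * h y (bvec k) (bvec l) := by
  simp only [raise, map_sum, map_smul, tr_smulRight, smul_eq_mul, flip_apply]

lemma contDiffOn_raise (hg : ContDiffOn ℝ ∞ g U)
    (hn : ∀ z ∈ U, ∀ u, (∀ v, g z u v = 0) → u = 0)
    {h : Vec n → Vec n →L[ℝ] Vec n →L[ℝ] ℝ} (hh : ContDiffOn ℝ ∞ h U) :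
    ContDiffOn ℝ ∞ (raise g h) U := by
  have h1 := contDiffOn_inv (contDiffOn_coordMat hg) fun z hz => det_coordMat_ne_zero (hn z hz)
  refine contDiffOn_clm_apply.2 fun u => ?_
  simp only [raise_apply]
  exact ContDiffOn.sum fun k _ => ContDiffOn.sum fun l _ => ContDiffOn.fun_smul
    ((h1 k l).mul ((hh.clm_apply contDiffOn_const).clm_apply contDiffOn_const)) contDiffOn_const

/-- The trace of `S` with an index raised is `r`, and that of `g` is `n`. Thus a constant `r`
supplies the hypothesis of `tr_T_eq_zero`. -/
lemma tr_raise_excess (hU : IsOpen U) (hΓ : ContDiffOn ℝ ∞ (levi g) U) (hy : y ∈ U)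
    (hs : ∀ u v, g y u v = g y v u) (hn : ∀ u, (∀ v, g y u v = 0) → u = 0) :
    tr (raise g (KenmotsuOn.excess g (levi g)) y)
      = scalar (coordMat g) y - (n : ℝ) * ((n : ℝ) - 1) := by
  have h : ∑ k, ∑ l, (coordMat g y)⁻¹ k l * coordMat g y k l = n := by
    rw [Finset.sum_comm]
    simp [sum_inv_mul hs hn]
  have h' : (n : ℝ) * ((n : ℝ) - 1)
      = ∑ k, ∑ l, (coordMat g y)⁻¹ k l * coordMat g y k l * ((n : ℝ) - 1) := by
    simp only [← Finset.sum_mul, h]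
  rw [tr_raise, scalar, h']
  simp only [KenmotsuOn.excess_apply, ricci_eq hU hΓ hy, coordMat_apply, finrank_euclideanSpace,
    Fintype.card_fin, ← Finset.sum_sub_distrib]
  exact Finset.sum_congr rfl fun k _ => Finset.sum_congr rfl fun l _ => by ring

lemma lieMetric_eq (hU : IsOpen U) (hg : ContDiffOn ℝ ∞ g U) {K : Vec n → Vec n}
    (hK : ContDiffOn ℝ ∞ K U) (hy : y ∈ U) (i j : Fin n) :
    lieMetric (coordMat g) (fun k z => K z k) i j y = lieBil K g y (bvec i) (bvec j) := by
  have h0 := differentiableAt_of_mem hU hK hy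
  simp only [lieMetric, pd_coordMat hU hg hy, pd_apply h0, Finset.sum_add_distrib]
  simp only [coordMat_apply]
  rw [lieBil_apply, clm_apply_eq_sum (fderiv ℝ g y) (K y),
    clm_apply_eq_sum (g y) (fderiv ℝ K y (bvec i)),
    clm_apply_eq_sum (g y (bvec i)) (fderiv ℝ K y (bvec j))]
  simp [mul_comm]

lemma covDerivEnd_eq (hU : IsOpen U) {φ : Vec n → Vec n →L[ℝ] Vec n} (hφ : ContDiffOn ℝ ∞ φ U)
    (hy : y ∈ U) (k i j : Fin n) :
    covDerivEnd (coordMat g) (fun k j z => φ z (bvec j) k) k i j y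
      = (fderiv ℝ φ y (bvec i) (bvec j) + levi g y (bvec i) (φ y (bvec j))
        - φ y (levi g y (bvec i) (bvec j))) k := by
  have h0 := differentiableAt_of_mem hU hφ hy
  rw [covDerivEnd, pd_apply (f := fun z => φ z (bvec j)) (by fun_prop), fderiv_apply_const h0,
    clm_apply_eq_sum (levi g y (bvec i)) (φ y (bvec j)),
    clm_apply_eq_sum (φ y) (levi g y (bvec i) (bvec j)), Finset.sum_sub_distrib]
  simp [levi_bvec, mul_comm]
  ring

variable {φ : Vec n → Vec n →L[ℝ] Vec n} {ζ K : Vec n → Vec n} {ν : Vec n → Vec n →L[ℝ] ℝ}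

lemma nabla_phi
    (hP : ∀ k i j, covDerivEnd (coordMat g) (fun k j z => φ z (bvec j) k) k i j y
      = - g y (φ y (bvec i)) (bvec j) * ζ y k - ν y (bvec j) * φ y (bvec i) k)
    (hU : IsOpen U) (hφ : ContDiffOn ℝ ∞ φ U) (hy : y ∈ U) (u v : Vec n) :
    fderiv ℝ φ y u v + levi g y u (φ y v) - φ y (levi g y u v)
      = - g y (φ y u) v • ζ y - ν y v • φ y u := by
  refine bvec_induction (p := fun u => fderiv ℝ φ y u v + levi g y u (φ y v) - φ y (levi g y u v)
      = - g y (φ y u) v • ζ y - ν y v • φ y u) ?_ ?_ ?_ (by simp) u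
  · intro a b ha hb
    simp only [map_add, _root_.add_apply]
    linear_combination (norm := module) ha + hb
  · intro c a ha
    simp only [map_smul, _root_.smul_apply, smul_eq_mul]
    linear_combination (norm := module) c • ha
  intro i
  refine bvec_induction (p := fun v => fderiv ℝ φ y (bvec i) v + levi g y (bvec i) (φ y v)
      - φ y (levi g y (bvec i) v)
      = - g y (φ y (bvec i)) v • ζ y - ν y v • φ y (bvec i)) ?_ ?_ ?_ (by simp) v
  · intro a b ha hb
    simp only [map_add]
    linear_combination (norm := module) ha + hb
  · intro c a ha
    simp only [map_smul, smul_eq_mul]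
    linear_combination (norm := module) c • ha
  intro j
  ext k
  rw [← covDerivEnd_eq hU hφ hy, hP]
  simp

/-- The Levi-Civita connection of an LP-Kenmotsu structure given in coordinates. -/
theorem kenmotsuOn_levi (hU : IsOpen U) (hg : ContDiffOn ℝ ∞ g U) (hφ : ContDiffOn ℝ ∞ φ U)
    (hζ : ContDiffOn ℝ ∞ ζ U) (hν : ContDiffOn ℝ ∞ ν U)
    (hs : ∀ z ∈ U, ∀ u v, g z u v = g z v u)
    (hn : ∀ z ∈ U, ∀ u, (∀ v, g z u v = 0) → u = 0)
    (hνζ : ∀ z ∈ U, ν z (ζ z) = -1) (hgζ : ∀ z ∈ U, ∀ u, g z u (ζ z) = ν z u)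
    (hφφ : ∀ z ∈ U, ∀ u, φ z (φ z u) = u + ν z u • ζ z) (hφζ : ∀ z ∈ U, φ z (ζ z) = 0)
    (hνφ : ∀ z ∈ U, ∀ u, ν z (φ z u) = 0)
    (hP : ∀ z ∈ U, ∀ k i j, covDerivEnd (coordMat g) (fun k j z => φ z (bvec j) k) k i j z
      = - g z (φ z (bvec i)) (bvec j) * ζ z k - ν z (bvec j) * φ z (bvec i) k) :
    KenmotsuOn U g (levi g) ζ ν where
  isOpen := hU
  smooth_g := hg
  smooth_Γ := contDiffOn_levi hU hg hn
  smooth_ζ := hζ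
  smooth_ν := hν
  symm_g := hs
  nondeg := hn
  symm_Γ := fun y hy u v => levi_symm hs hU hy u v
  compat := fun y hy a u v => metric_levi_compat hU hg hs hn hy a u v
  ν_ζ := hνζ
  g_ζ := hgζ
  fderiv_ζ := by
    intro y hy u
    have h0 := differentiableAt_of_mem hU hg hy
    have h1 := differentiableAt_of_mem hU hζ hy
    have h2 := differentiableAt_of_mem hU hφ hy
    have e1 : fderiv ℝ (fun z => φ z (ζ z)) y u = 0 := by
      rw [fderiv_congr_on hU hy hφζ]; simp
    rw [fderiv_apply_apply h2 h1] at e1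
    have e2 := nabla_phi (hP y hy) hU hφ hy u (ζ y)
    rw [hφζ y hy, map_zero, hgζ y hy, hνφ y hy, hνζ y hy] at e2
    have e3 : fderiv ℝ (fun z => g z (ζ z) (ζ z)) y u = 0 := by
      rw [fderiv_congr_on hU hy fun z hz => (by rw [hgζ z hz, hνζ z hz] : g z (ζ z) (ζ z) = -1)]
      simp
    rw [fderiv_apply_apply (c := fun z => g z (ζ z)) (by fun_prop) h1,
      fderiv_apply_apply h0 h1, _root_.add_apply, metric_levi_compat hU hg hs hn hy, hs y hy (ζ y),
      hs y hy (ζ y)] at e3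
    simp only [hgζ y hy] at e3
    -- Two values of `(∇_u φ)ζ`: differentiating `φζ = 0` gives `-φ(∇_u ζ)`, and the LP-Kenmotsu
    -- identity gives `φu`.
    have e4 : φ y (fderiv ℝ ζ y u + levi g y u (ζ y)) = - φ y u := by
      rw [map_add]
      linear_combination (norm := module) e1 - e2
    have e5 := congrArg (φ y) e4
    -- `e3` says `ν(∇_u ζ) = 0`, so `φ²` fixes `∇_u ζ`, and applying `φ` to `e4` solves for it.
    rw [hφφ y hy, map_neg, hφφ y hy, show ν y (fderiv ℝ ζ y u + levi g y u (ζ y)) = 0 by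
      rw [map_add]; linarith, zero_smul, add_zero] at e5
    rw [eq_sub_of_add_eq e5]
    module

/-- The constants of a soliton on an LP-Kenmotsu structure given in coordinates. -/
theorem soliton_constants_of_kenmotsuOn (H : KenmotsuOn U g (levi g) ζ ν) (hn : 2 ≤ n)
    (hy : y ∈ U) {c : ℝ} (hr : ∀ z ∈ U, scalar (coordMat g) z = c)
    (hK : ContDiffOn ℝ ∞ K U) {σ ρ Λ : ℝ}
    (hS : ∀ z ∈ U, ∀ i j, lieMetric (coordMat g) (fun k z => K z k) i j z
      + 2 * σ * ricci (coordMat g) i j z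
      + (2 * Λ - ρ * scalar (coordMat g) z) * coordMat g z i j = 0) :
    c = (n : ℝ) * ((n : ℝ) - 1) ∧ 2 * Λ - ρ * c = - 2 * σ * ((n : ℝ) - 1) := by
  have hT : ∀ z ∈ U, ∀ u v, g z (raise g (KenmotsuOn.excess g (levi g)) z u) v
      = KenmotsuOn.excess g (levi g) z u v := fun z hz =>
    metric_raise (H.symm_g z hz) (H.nondeg z hz) _
  have hTs := contDiffOn_raise H.smooth_g H.nondeg H.smooth_excess
  have hc : c - (n : ℝ) * ((n : ℝ) - 1) = 0 := H.tr_T_eq_zero hT hTs (fun z hz => by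
    rw [tr_raise_excess H.isOpen H.smooth_Γ hz (H.symm_g z hz) (H.nondeg z hz), hr z hz]) hy
  have hS' : ∀ z ∈ U, ∀ u v, lieBil K g z u v + 2 * σ * ric (levi g) z u v
      + (2 * Λ - ρ * c) * g z u v = 0 := by
    intro z hz u v
    refine bvec_induction (p := fun u => lieBil K g z u v + 2 * σ * ric (levi g) z u v
      + (2 * Λ - ρ * c) * g z u v = 0) ?_ ?_ ?_ (by simp) u
    · intro a b ha hb
      simp only [map_add, _root_.add_apply]
      linear_combination ha + hb
    · intro c a ha
      simp only [map_smul, _root_.smul_apply, smul_eq_mul]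
      linear_combination c * ha
    intro i
    refine bvec_induction (p := fun v => lieBil K g z (bvec i) v
      + 2 * σ * ric (levi g) z (bvec i) v + (2 * Λ - ρ * c) * g z (bvec i) v = 0) ?_ ?_ ?_
      (by simp) v
    · intro a b ha hb
      simp only [map_add]
      linear_combination ha + hb
    · intro c a ha
      simp only [map_smul, smul_eq_mul]
      linear_combination c * ha
    intro j
    have h := hS z hz i j
    rwa [lieMetric_eq H.isOpen H.smooth_g hK hz, ricci_eq H.isOpen H.smooth_Γ hz, hr z hz] at h
  have hf := H.soliton_constant hK hS' hT hTs hy (by simpa using hn)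
  rw [finrank_euclideanSpace, Fintype.card_fin] at hf
  exact ⟨by linarith, hf⟩

end LocalGeom

/-! ## The fields of a manifold in a chart -/

namespace ChartFields

open FlatCalculus LocalGeom

set_option maxSynthPendingDepth 3

variable {n : ℕ} {M : Type*} [TopologicalSpace M] [ChartedSpace (EuclideanSpace ℝ (Fin n)) M]

/-- The derivative of the chart. -/
noncomputable def toVec (e : OpenPartialHomeomorph M (EuclideanSpace ℝ (Fin n))) (x : M) :
    TangentSpace (𝓡 n) x →L[ℝ] Vec n := mfderiv (𝓡 n) (𝓡 n) e x

/-- The derivative of the inverse of the chart. -/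
noncomputable def ofVec (e : OpenPartialHomeomorph M (EuclideanSpace ℝ (Fin n))) (y : Vec n) :
    Vec n →L[ℝ] TangentSpace (𝓡 n) (e.symm y) := mfderiv (𝓡 n) (𝓡 n) e.symm y

variable [IsManifold (𝓡 n) ∞ M]

section Atlas

variable {e : OpenPartialHomeomorph M (EuclideanSpace ℝ (Fin n))}

lemma isManifold_one : IsManifold (𝓡 n) 1 M := IsManifold.of_le (n := ∞) (by simp)

lemma toVec_ofVec (he : e ∈ atlas (EuclideanSpace ℝ (Fin n)) M) {y : Vec n} (hy : y ∈ e.target)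
    (u : Vec n) : toVec e (e.symm y) (ofVec e y u) = u := by
  have := isManifold_one (n := n) (M := M)
  have h := (mdifferentiable_of_mem_atlas (I := 𝓡 n) he).comp_symm_deriv hy
  exact DFunLike.congr_fun h u

lemma ofVec_toVec (he : e ∈ atlas (EuclideanSpace ℝ (Fin n)) M) {y : Vec n} (hy : y ∈ e.target)
    (u : TangentSpace (𝓡 n) (e.symm y)) : ofVec e y (toVec e (e.symm y) u) = u := by
  have := isManifold_one (n := n) (M := M)
  have h := (mdifferentiable_of_mem_atlas (I := 𝓡 n) he).symm.comp_symm_deriv (x := e.symm y)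
    (e.map_target hy)
  rw [e.symm_symm, e.right_inv hy] at h
  exact DFunLike.congr_fun h u

/-- The vector field with constant components `u`. -/
noncomputable def constField (e : OpenPartialHomeomorph M (EuclideanSpace ℝ (Fin n))) (u : Vec n)
    (x : M) : TangentSpace (𝓡 n) x := (toVec e x).inverse u

lemma constField_symm (he : e ∈ atlas (EuclideanSpace ℝ (Fin n)) M) {y : Vec n}
    (hy : y ∈ e.target) (u : Vec n) : constField e u (e.symm y) = ofVec e y u := by
  rw [constField, ContinuousLinearMap.inverse_eq (g := ofVec e y)]
  · ext1 v; exact toVec_ofVec he hy v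
  · ext1 v; exact ofVec_toVec he hy v

lemma toVec_constField (he : e ∈ atlas (EuclideanSpace ℝ (Fin n)) M) {x : M} (hx : x ∈ e.source)
    (u : Vec n) : toVec e x (constField e u x) = u := by
  have h := toVec_ofVec he (e.map_source hx) u
  rw [← constField_symm he (e.map_source hx), e.left_inv hx] at h
  exact h

end Atlas

variable (x₀ : M)

/-- The tangent bundle trivialization at `x₀` is the derivative of the chart at `x₀`, so smoothness
of a section becomes smoothness of its chart components. -/
lemma trivialization_snd {x : M} (hx : x ∈ (chartAt (Vec n) x₀).source)
    (v : TangentSpace (𝓡 n) x) :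
    (trivializationAt (EuclideanSpace ℝ (Fin n)) (TangentSpace (𝓡 n)) x₀ ⟨x, v⟩).2
      = toVec (chartAt (Vec n) x₀) x v := by
  have := isManifold_one (n := n) (M := M)
  have h := TangentBundle.continuousLinearMapAt_trivializationAt (I := 𝓡 n) (𝕜 := ℝ) hx
  have h' := DFunLike.congr_fun h v
  rw [Trivialization.continuousLinearMapAt_apply,
    Trivialization.linearMapAt_apply, if_pos (by simpa using hx)] at h'
  rw [h']
  simp [toVec]

lemma contMDiffOn_field_iff {X : ∀ x : M, TangentSpace (𝓡 n) x} :
    ContMDiffOn (𝓡 n) ((𝓡 n).prod 𝓘(ℝ, EuclideanSpace ℝ (Fin n))) ∞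
      (fun x => TotalSpace.mk' (EuclideanSpace ℝ (Fin n))
        (E := fun x : M => TangentSpace (𝓡 n) x) x (X x))
      (chartAt (Vec n) x₀).source ↔
    ContMDiffOn (𝓡 n) 𝓘(ℝ, EuclideanSpace ℝ (Fin n)) ∞
      (fun x => toVec (chartAt (Vec n) x₀) x (X x))
      (chartAt (Vec n) x₀).source := by
  rw [(trivializationAt (EuclideanSpace ℝ (Fin n)) (TangentSpace (𝓡 n)) x₀).contMDiffOn_section_iff
    (chartAt (Vec n) x₀).open_source (by simp)]
  exact contMDiffOn_congr fun x hx => trivialization_snd x₀ hx (X x)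

lemma contMDiffOn_constField (u : Vec n) :
    ContMDiffOn (𝓡 n) ((𝓡 n).prod 𝓘(ℝ, EuclideanSpace ℝ (Fin n))) ∞
      (fun x => TotalSpace.mk' (EuclideanSpace ℝ (Fin n))
        (E := fun x : M => TangentSpace (𝓡 n) x) x
        (constField (chartAt (Vec n) x₀) u x))
      (chartAt (Vec n) x₀).source := by
  rw [contMDiffOn_field_iff]
  exact contMDiffOn_const.congr fun x hx => toVec_constField (chart_mem_atlas _ x₀) hx u

lemma contDiffOn_comp_symm {F : Type*} [NormedAddCommGroup F] [NormedSpace ℝ F] {f : M → F}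
    (hf : ContMDiffOn (𝓡 n) 𝓘(ℝ, F) ∞ f (chartAt (Vec n) x₀).source) :
    ContDiffOn ℝ ∞ (fun y => f ((chartAt (Vec n) x₀).symm y))
      (chartAt (Vec n) x₀).target := by
  rw [← contMDiffOn_iff_contDiffOn]
  exact hf.comp (contMDiffOn_chart_symm (x := x₀)) fun y hy =>
    (chartAt (Vec n) x₀).map_target hy

/-- The components of a metric as a bilinear form on the coordinate space. -/
noncomputable def metricField (g : LorentzianMetric n M) (y : Vec n) :
    Vec n →L[ℝ] Vec n →L[ℝ] ℝ :=
  (((ofVec (chartAt (Vec n) x₀) y).precomp ℝ).comp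
    (g.val ((chartAt (Vec n) x₀).symm y))).comp
      (ofVec (chartAt (Vec n) x₀) y)

/-- The components of a vector field. -/
noncomputable def vecField (X : ∀ x : M, TangentSpace (𝓡 n) x) (y : Vec n) : Vec n :=
  toVec (chartAt (Vec n) x₀) _
    (X ((chartAt (Vec n) x₀).symm y))

/-- The components of an endomorphism field. -/
noncomputable def endField (A : ∀ x : M, TangentSpace (𝓡 n) x →L[ℝ] TangentSpace (𝓡 n) x)
    (y : Vec n) : Vec n →L[ℝ] Vec n :=
  (toVec (chartAt (Vec n) x₀) _).comp
    ((A ((chartAt (Vec n) x₀).symm y)).comp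
      (ofVec (chartAt (Vec n) x₀) y))

/-- The components of a 1-form. -/
noncomputable def formField (ν : ∀ x : M, TangentSpace (𝓡 n) x →L[ℝ] ℝ) (y : Vec n) :
    Vec n →L[ℝ] ℝ :=
  (ν ((chartAt (Vec n) x₀).symm y)).comp
    (ofVec (chartAt (Vec n) x₀) y)

/-- Smoothness is tested by evaluating `g` on the smooth fields with constant components; the 1-form
and endomorphism cases go the same way. -/
lemma contDiffOn_metricField (g : LorentzianMetric n M) :
    ContDiffOn ℝ ∞ (metricField x₀ g) (chartAt (Vec n) x₀).target := by
  refine contDiffOn_clm_apply.2 fun u => contDiffOn_clm_apply.2 fun v => ?_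
  have h : ContMDiffOn (𝓡 n) ((𝓡 n).prod 𝓘(ℝ, ℝ)) ∞ (fun x => TotalSpace.mk' ℝ
      (E := Bundle.Trivial M ℝ) x (g.val x
        (constField (chartAt (Vec n) x₀) u x)
        (constField (chartAt (Vec n) x₀) v x)))
      (chartAt (Vec n) x₀).source :=
    ContMDiffOn.clm_bundle_apply₂ (F₁ := EuclideanSpace ℝ (Fin n))
      (F₂ := EuclideanSpace ℝ (Fin n)) g.contMDiff.contMDiffOn
      (contMDiffOn_constField x₀ u) (contMDiffOn_constField x₀ v)
  have h' : ContMDiffOn (𝓡 n) 𝓘(ℝ, ℝ) ∞ (fun x => g.val x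
        (constField (chartAt (Vec n) x₀) u x)
        (constField (chartAt (Vec n) x₀) v x))
      (chartAt (Vec n) x₀).source := fun x hx => by
    have k := h x hx
    simp only [contMDiffWithinAt_totalSpace] at k
    exact k.2
  refine (contDiffOn_comp_symm x₀ h').congr fun y hy => ?_
  rw [constField_symm (chart_mem_atlas _ x₀) hy, constField_symm (chart_mem_atlas _ x₀) hy]
  rfl

lemma contDiffOn_vecField {X : ∀ x : M, TangentSpace (𝓡 n) x} (hX : IsSmoothVectorField X) :
    ContDiffOn ℝ ∞ (vecField x₀ X) (chartAt (Vec n) x₀).target :=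
  contDiffOn_comp_symm x₀ ((contMDiffOn_field_iff x₀).1 (ContMDiff.contMDiffOn hX))

lemma contDiffOn_formField {g : LorentzianMetric n M} (P : AlmostParacontact g) :
    ContDiffOn ℝ ∞ (formField x₀ P.ν) (chartAt (Vec n) x₀).target := by
  refine contDiffOn_clm_apply.2 fun u => ?_
  have h : ContMDiffOn (𝓡 n) ((𝓡 n).prod 𝓘(ℝ, ℝ)) ∞ (fun x => TotalSpace.mk' ℝ
      (E := Bundle.Trivial M ℝ) x (P.ν x
        (constField (chartAt (Vec n) x₀) u x)))
      (chartAt (Vec n) x₀).source :=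
    ContMDiffOn.clm_bundle_apply (F₁ := EuclideanSpace ℝ (Fin n)) P.smooth_ν.contMDiffOn
      (contMDiffOn_constField x₀ u)
  have h' : ContMDiffOn (𝓡 n) 𝓘(ℝ, ℝ) ∞ (fun x => P.ν x
        (constField (chartAt (Vec n) x₀) u x))
      (chartAt (Vec n) x₀).source := fun x hx => by
    have k := h x hx
    simp only [contMDiffWithinAt_totalSpace] at k
    exact k.2
  refine (contDiffOn_comp_symm x₀ h').congr fun y hy => ?_
  rw [constField_symm (chart_mem_atlas _ x₀) hy]
  rfl

lemma contDiffOn_endField {g : LorentzianMetric n M} (P : AlmostParacontact g) :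
    ContDiffOn ℝ ∞ (endField x₀ P.φ) (chartAt (Vec n) x₀).target := by
  refine contDiffOn_clm_apply.2 fun u => ?_
  have h : ContMDiffOn (𝓡 n) ((𝓡 n).prod 𝓘(ℝ, EuclideanSpace ℝ (Fin n))) ∞
      (fun x => TotalSpace.mk' (EuclideanSpace ℝ (Fin n))
        (E := fun x : M => TangentSpace (𝓡 n) x) x (P.φ x
        (constField (chartAt (Vec n) x₀) u x)))
      (chartAt (Vec n) x₀).source :=
    ContMDiffOn.clm_bundle_apply (F₁ := EuclideanSpace ℝ (Fin n)) P.smooth_φ.contMDiffOn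
      (contMDiffOn_constField x₀ u)
  refine (contDiffOn_comp_symm x₀ ((contMDiffOn_field_iff x₀).1 h)).congr fun y hy => ?_
  rw [constField_symm (chart_mem_atlas _ x₀) hy]
  rfl

end ChartFields

/-! ### From the chart back to the manifold. -/

section Soliton

open FlatCalculus LocalGeom ChartFields

set_option maxSynthPendingDepth 3

variable {n : ℕ} {M : Type*} [TopologicalSpace M] [ChartedSpace (EuclideanSpace ℝ (Fin n)) M]
  [IsManifold (𝓡 n) ∞ M]

/-- A nonzero vector of the radical would be orthogonal to the timelike vector, hence of positive
square, yet it is orthogonal to itself. -/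
lemma LorentzianMetric.eq_zero_of_forall (g : LorentzianMetric n M) {x : M}
    {u : TangentSpace (𝓡 n) x} (h : ∀ v, g.val x u v = 0) : u = 0 := by
  obtain ⟨t, -, ht⟩ := g.lorentzian x
  by_contra hu
  exact (ht u hu (by rw [g.symm, h])).ne' (h u)

theorem AlmostParacontact.IsLPKenmotsu.kenmotsuOn {g : LorentzianMetric n M}
    {P : AlmostParacontact g} (hP : P.IsLPKenmotsu) (x₀ : M) :
    KenmotsuOn (chartAt (EuclideanSpace ℝ (Fin n)) x₀).target (metricField x₀ g)
      (levi (metricField x₀ g)) (vecField x₀ P.ζ) (formField x₀ P.ν) := by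
  have he := chart_mem_atlas (EuclideanSpace ℝ (Fin n)) x₀
  have hAB := fun {y} (hy : y ∈ (chartAt (EuclideanSpace ℝ (Fin n)) x₀).target) =>
    ofVec_toVec he hy
  have hBA := fun {y} (hy : y ∈ (chartAt (EuclideanSpace ℝ (Fin n)) x₀).target) =>
    toVec_ofVec he hy
  have eg : ∀ y u v, metricField x₀ g y u v = g.val _ (ofVec (chartAt (Vec n) x₀) y u)
    (ofVec (chartAt (Vec n) x₀) y v) := fun _ _ _ => rfl
  have eφ : ∀ y u, endField x₀ P.φ y u = toVec (chartAt (Vec n) x₀) _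
    (P.φ _ (ofVec (chartAt (Vec n) x₀) y u)) := fun _ _ => rfl
  have eν : ∀ y u, formField x₀ P.ν y u = P.ν _ (ofVec (chartAt (Vec n) x₀) y u) :=
    fun _ _ => rfl
  have eζ : ∀ y, vecField x₀ P.ζ y = toVec (chartAt (Vec n) x₀) _ (P.ζ _) := fun _ => rfl
  refine kenmotsuOn_levi (φ := endField x₀ P.φ) (chartAt (Vec n) x₀).open_target
    (contDiffOn_metricField x₀ g) (contDiffOn_endField x₀ P) (contDiffOn_vecField x₀ P.smooth_ζ)
    (contDiffOn_formField x₀ P) (fun y _ u v => g.symm _ _ _) ?_ ?_ ?_ ?_ ?_ ?_ ?_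
  · intro y hy u hu
    have h : ofVec (chartAt (Vec n) x₀) y u = 0 := g.eq_zero_of_forall fun v => by
      have := hu (toVec (chartAt (Vec n) x₀) _ v)
      rwa [eg, hAB hy] at this
    rw [← hBA hy u, h, map_zero]
  · intro y hy
    rw [eν, eζ, hAB hy]
    linarith [P.ν_ζ ((chartAt (Vec n) x₀).symm y)]
  · intro y hy u
    rw [eg, eν, eζ, hAB hy, P.metric_ζ]
  · intro y hy u
    rw [eφ, eφ, eν, eζ, hAB hy, P.φ_sq, map_add, map_smul, hBA hy]
  · intro y hy
    rw [eφ, eζ, hAB hy, P.φ_ζ, map_zero]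
  · intro y hy u
    rw [eν, eφ, hAB hy, P.ν_φ]
  · intro y hy k i j
    rw [eg, eφ, hAB hy]
    exact hP _ he y hy k i j

/-- The constants of a Ricci-Yamabe soliton on an LP-Kenmotsu manifold of constant scalar
curvature. -/
theorem IsRicciYamabeSoliton.constant_eq (hn : 2 ≤ n) [Nonempty M] {g : LorentzianMetric n M}
    {P : AlmostParacontact g} (hP : P.IsLPKenmotsu) (hr : g.HasConstantScalarCurvature)
    {K : ∀ x : M, TangentSpace (𝓡 n) x} {Λ σ ρ : ℝ} (hK : IsRicciYamabeSoliton g K Λ σ ρ) :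
    2 * Λ = ρ * ((n : ℝ) * ((n : ℝ) - 1)) - 2 * σ * ((n : ℝ) - 1) := by
  obtain ⟨x₀⟩ := ‹Nonempty M›
  obtain ⟨c, hc⟩ := hr
  have he := chart_mem_atlas (EuclideanSpace ℝ (Fin n)) x₀
  obtain ⟨h1, h2⟩ := soliton_constants_of_kenmotsuOn (hP.kenmotsuOn x₀) hn
    ((chartAt (Vec n) x₀).map_source (mem_chart_source _ x₀)) (hc _ he)
    (contDiffOn_vecField x₀ hK.1) (hK.2 _ he)
  rw [h1] at h2
  linarith

end Soliton

theorem mainTheorem2 {n : ℕ} (hn : 2 ≤ n) {M : Type*} [TopologicalSpace M] [Nonempty M]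
    [ChartedSpace (EuclideanSpace ℝ (Fin n)) M] [IsManifold (𝓡 n) ∞ M]
    (g : LorentzianMetric n M) (P : AlmostParacontact g) (hP : P.IsLPKenmotsu)
    (hr : g.HasConstantScalarCurvature)
    (K : ∀ x : M, TangentSpace (𝓡 n) x) (Λ : ℝ) :
    (IsRicciSoliton g K Λ →
      Λ = -((n : ℝ) - 1) ∧ SolitonShrinking Λ) ∧
    (IsYamabeSoliton g K Λ →
      Λ = (n : ℝ) * ((n : ℝ) - 1) / 2 ∧ SolitonExpanding Λ) ∧
    (IsEinsteinSoliton g K Λ →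
      Λ = -(((n : ℝ) - 1) * ((n : ℝ) + 2)) / 2 ∧ SolitonShrinking Λ) := by
  have hn' : (2 : ℝ) ≤ n := by exact_mod_cast hn
  refine ⟨fun h => ?_, fun h => ?_, fun h => ?_⟩
  all_goals have e := IsRicciYamabeSoliton.constant_eq hn hP hr h
  · exact ⟨by linarith, show Λ < 0 by linarith⟩
  · exact ⟨by linarith, show 0 < Λ by nlinarith⟩
  · exact ⟨by linarith, show Λ < 0 by nlinarith⟩
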